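/- Let $\mathcal H$ be an infinite-dimensional separable complex Hilbert space, let $C$ be a trace-class operator on $\mathcal H$ and $T$ a compact operator on $\mathcal H$, both normal, and assume that the set of all eigenvalues of $C$ or the set of all eigenvalues of $T$ is contained in a line in the complex plane ($0$ is included whenever it is an eigenvalue). Let $$W_C(T)=\{\operatorname{tr}(CU^\dagger TU)\mid U\in\mathcal B(\mathcal H)\text{ unitary}\}$$ be the $C$-numerical range of $T$. A modified eigenvalue sequence of a compact operator $A$ on $\mathcal H$ is a sequence of complex numbers, indexed by $\mathbb N$ and in any order, in which every non-zero eigenvalue of $A$ occurs as often as its algebraic multiplicity, in which no other non-zero number occurs, and in which zero occurs exactly $\dim\ker A$ times (infinitely often if $\ker A$ is infinite-dimensional) if $A$ has infinitely many non-zero eigenvalues, and infinitely often otherwise. Then $C$ and $T$ have modified eigenvalue sequences, and for any modified eigenvalue sequences $(\gamma_n)_{n\in\mathbb N}$ of $C$ and $(\tau_n)_{n\in\mathbb N}$ of $T$, all series $\sum_{n=1}^\infty\gamma_n\tau_{\sigma(n)}$ with $\sigma$ a permutation of $\mathbb N$ converge absolutely, and the $C$-spectrum $$P_C(T)=\Big\{\sum_{n=1}^\infty\gamma_n\tau_{\sigma(n)}\;\Big|\;\sigma:\mathbb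 N\to\mathbb N\text{ is a permutation}\Big\}$$ satisfies $$\overline{W_C(T)}=\operatorname{conv}\big(\overline{P_C(T)}\big).$$ -/

import Mathlib

open Set Filter Topology
open scoped InnerProductSpace

namespace CNumRange

variable {H : Type*} [NormedAddCommGroup H] [InnerProductSpace ℂ H] [CompleteSpace H]

/-- `C` belongs to the trace class of the infinite-dimensional Hilbert space `H`: it is compact and
has a Schmidt decomposition `C = ∑ₙ sₙ ⟨fₙ, ·⟩ gₙ` (convergent in operator norm) with orthonormal
systems `f`, `g` and a decreasing sequence of singular numbers `sₙ ≥ 0` that is summable.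
Here `InnerProductSpace.rankOne ℂ y x` is the operator `⟨x, ·⟩ y`. -/
def IsTraceClass (C : H →L[ℂ] H) : Prop :=
  IsCompactOperator C ∧
    ∃ (s : ℕ → ℝ) (f g : ℕ → H),
      Antitone s ∧ (∀ n, 0 ≤ s n) ∧ Summable s ∧ Orthonormal ℂ f ∧ Orthonormal ℂ g ∧
        HasSum (fun n => (s n : ℂ) • InnerProductSpace.rankOne ℂ (g n) (f n)) C

/-- The trace `∑ᵢ ⟨bᵢ, A bᵢ⟩`, computed in some orthonormal basis `b` of `H`. For operators `C * A`
with `C` of trace class and `A` bounded the series converges in every orthonormal basis, and to the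
same value: see `IsTraceClass.hasSum_opTrace_mul`. -/
noncomputable def opTrace (A : H →L[ℂ] H) : ℂ :=
  ∑' i : (exists_hilbertBasis ℂ H).choose, ⟪(i : H), A i⟫_ℂ

lemma summable_sq {H : Type*} [NormedAddCommGroup H] [InnerProductSpace ℂ H] (ι : Type*) (b : HilbertBasis ι ℂ H) (x : H) :
    Summable (fun i => ‖⟪b i, x⟫_ℂ‖ ^ 2) ∧ ∑' i, ‖⟪b i, x⟫_ℂ‖ ^ 2 ≤ ‖x‖ ^ 2 :=
  ⟨b.orthonormal.inner_products_summable x, b.orthonormal.tsum_inner_products_le x⟩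

lemma hasSum_trace_aux {s : ℕ → ℝ} {f g : ℕ → H} (hs0 : ∀ n, 0 ≤ s n) (hs : Summable s)
    (hf : Orthonormal ℂ f) (hg : Orthonormal ℂ g) {C : H →L[ℂ] H}
    (hC : HasSum (fun n => (s n : ℂ) • InnerProductSpace.rankOne ℂ (g n) (f n)) C)
    (A : H →L[ℂ] H) {ι : Type*} (b : HilbertBasis ι ℂ H) :
    HasSum (fun i => ⟪b i, (C * A) (b i)⟫_ℂ) (∑' n, (s n : ℂ) * ⟪star A (f n), g n⟫_ℂ) := by
  set u : ℕ → H := fun n => star A (f n) with hu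
  set F : ℕ × ι → ℂ := fun p => (s p.1 : ℂ) * (⟪u p.1, b p.2⟫_ℂ * ⟪b p.2, g p.1⟫_ℂ) with hF
  have hrow : ∀ n, HasSum (fun i => F (n, i)) ((s n : ℂ) * ⟪u n, g n⟫_ℂ) := fun n =>
    (b.hasSum_inner_mul_inner (u n) (g n)).mul_left _
  have hcol : ∀ i, HasSum (fun n => F (n, i)) ⟪b i, (C * A) (b i)⟫_ℂ := by
    intro i
    have h1 := (hC.mapL (ContinuousLinearMap.apply ℂ H (A (b i)))).mapL (innerSL ℂ (b i))
    have h2 : (fun n => F (n, i)) = fun n => innerSL ℂ (b i) (ContinuousLinearMap.apply ℂ H (A (b i))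
        ((s n : ℂ) • InnerProductSpace.rankOne ℂ (g n) (f n))) := by
      funext n
      simp [hF, hu, ContinuousLinearMap.star_eq_adjoint, ContinuousLinearMap.adjoint_inner_left]
    rw [h2]
    exact h1
  have hsum : Summable F := by
    rw [← summable_norm_iff, summable_prod_of_nonneg (fun _ => norm_nonneg _)]
    refine ⟨fun n => (hrow n).summable.norm, ?_⟩
    refine Summable.of_nonneg_of_le (fun n => tsum_nonneg fun _ => norm_nonneg _) (fun n => ?_)
      (hs.mul_right ((‖star A‖ ^ 2 + 1) / 2))
    obtain ⟨h1, h1'⟩ := summable_sq ι b (u n)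
    obtain ⟨h2, h2'⟩ := summable_sq ι b (g n)
    have hun : ‖u n‖ ≤ ‖star A‖ := by
      simpa [hf.1 n] using (star A).le_opNorm (f n)
    have hgn : ‖g n‖ = 1 := hg.1 n
    have h3 := ((h1.add h2).mul_left (s n / 2))
    calc ∑' i, ‖F (n, i)‖
        ≤ ∑' i, s n / 2 * (‖⟪b i, u n⟫_ℂ‖ ^ 2 + ‖⟪b i, g n⟫_ℂ‖ ^ 2) := by
          refine (hrow n).summable.norm.tsum_le_tsum (fun i => ?_) h3
          simp only [hF, norm_mul, Complex.norm_real, Real.norm_of_nonneg (hs0 n),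
            norm_inner_symm (u n) (b i)]
          nlinarith [mul_nonneg (hs0 n) (sq_nonneg (‖⟪b i, u n⟫_ℂ‖ - ‖⟪b i, g n⟫_ℂ‖))]
      _ = s n / 2 * (∑' i, ‖⟪b i, u n⟫_ℂ‖ ^ 2 + ∑' i, ‖⟪b i, g n⟫_ℂ‖ ^ 2) := by
          rw [tsum_mul_left, h1.tsum_add h2]
      _ ≤ s n / 2 * (‖star A‖ ^ 2 + 1) := by
          have h5 : ‖u n‖ ^ 2 ≤ ‖star A‖ ^ 2 := by gcongr
          rw [hgn] at h2'
          exact mul_le_mul_of_nonneg_left (by linarith) (by linarith [hs0 n])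
      _ = s n * ((‖star A‖ ^ 2 + 1) / 2) := by ring
  have hsw : Summable (F ∘ Prod.swap) := (Equiv.prodComm ι ℕ).summable_iff.2 hsum
  have hT : ∑' p, (F ∘ Prod.swap) p = ∑' n, (s n : ℂ) * ⟪u n, g n⟫_ℂ := by
    rw [show ∑' p, (F ∘ Prod.swap) p = ∑' p, F p from (Equiv.prodComm ι ℕ).tsum_eq F,
      hsum.tsum_prod]
    exact tsum_congr fun n => (hrow n).tsum_eq
  rw [← hT]
  exact hsw.hasSum.prod_fiberwise hcol

/-- The trace of `C * A`, for `C` of trace class and `A` bounded, is the sum of the diagonal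
entries in any orthonormal basis. -/
theorem IsTraceClass.hasSum_opTrace_mul {C : H →L[ℂ] H} (hC : IsTraceClass C) (A : H →L[ℂ] H)
    {ι : Type*} (b : HilbertBasis ι ℂ H) :
    HasSum (fun i => ⟪b i, (C * A) (b i)⟫_ℂ) (opTrace (C * A)) := by
  obtain ⟨-, s, f, g, -, hs0, hs, hf, hg, hsum⟩ := hC
  have hb := (exists_hilbertBasis ℂ H).choose_spec
  obtain ⟨b₀, hb₀⟩ := hb
  have h0 := (hasSum_trace_aux hs0 hs hf hg hsum A b₀).tsum_eq
  have h1 : opTrace (C * A) = ∑' n, (s n : ℂ) * ⟪star A (f n), g n⟫_ℂ := by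
    rw [← h0, opTrace, hb₀]
  rw [h1]
  exact hasSum_trace_aux hs0 hs hf hg hsum A b

/-- The `C`-numerical range `{tr(C U† T U) | U unitary}` of `T`. -/
def cNumericalRange (C T : H →L[ℂ] H) : Set ℂ :=
  {z | ∃ U ∈ unitary (H →L[ℂ] H), z = opTrace (C * (star U * T * U))}

/-- The set of eigenvalues of `T`. -/
def eigenvalues (T : H →L[ℂ] H) : Set ℂ :=
  {z | Module.End.HasEigenvalue (T : Module.End ℂ H) z}

/-- `τ` is a modified eigenvalue sequence of the compact operator `T`.
* Every `z ≠ 0` occurs in `τ` as often as its algebraic multiplicity says, that is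
  `dim ⋃ₖ ker (T - z)ᵏ` times (so not at all if `z` is not an eigenvalue).
* If `T` has only finitely many nonzero eigenvalues, then the sequence is filled up with
  infinitely many zeros (no condition is needed, since `τ` is indexed by `ℕ`). Otherwise `T` has
  infinite-dimensional range, and zero occurs exactly `dim ker T` times in `τ`, which means
  infinitely often if the kernel is infinite-dimensional.

The order of the entries is left free: arbitrary permutations are applied to the sequence in the
`C`-spectrum, so that no particular arrangement matters. -/
structure IsModifiedEigenvalueSeq (T : H →L[ℂ] H) (τ : ℕ → ℂ) : Prop where
  encard_ne_zero : ∀ z : ℂ, z ≠ 0 →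
    {n | τ n = z}.encard =
      Cardinal.toENat (Module.rank ℂ (Module.End.maxGenEigenspace (T : Module.End ℂ H) z))
  encard_zero : {n | τ n ≠ 0}.Infinite →
    {n | τ n = 0}.encard = Cardinal.toENat (Module.rank ℂ (T : H →ₗ[ℂ] H).ker)

/-- The set of all sums `∑ₙ γₙ τ_{σ(n)}`, where `σ` runs through the permutations of `ℕ`. If `γ` and
`τ` are modified eigenvalue sequences of `C` and `T`, this is the `C`-spectrum `P_C(T)`. -/
def cSpectrum (γ τ : ℕ → ℂ) : Set ℂ :=
  {z | ∃ σ : Equiv.Perm ℕ, HasSum (fun n => γ n * τ (σ n)) z}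

end CNumRange

/-! Compact normal operators are diagonal in orthonormal bases: C eₙ = γₙ eₙ and T fₙ = τₙ fₙ, where
γ is summable and τ tends to 0. Hence tr(C U†TU) = ∑ₙ γₙ ∑ₘ |⟨fₘ, U eₙ⟩|² τₘ. Both inclusions pass
through `finSpectrum`, the sums belonging to finitely supported permutations; it is dense in the
`C`-spectrum because γ has small tails.

The matrix |⟨fₘ, U eₙ⟩|² has row and column sums at most 1. A large finite corner of it extends to a
doubly stochastic matrix, and Birkhoff's theorem turns this into a convex combination of
permutations. What lies outside the corner contributes little. So the numerical range lies in the
closed convex hull of `finSpectrum` (`tsum_substochastic_mem_closure`, `cNumericalRange_subset`);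
collinearity plays no role here.

Conversely, eigenvalues on a line that tend to 0 have the form ω rₙ with |ω| = 1 and rₙ real, so one
of the operators is a phase times a self-adjoint one. A convex combination of finitely supported
rearrangements of r is majorized by r on a finite set. By Hardy–Littlewood–Pólya
(`MajorizedOn.induction`) it arises from r by averaging pairs of entries, and each averaging is
realized by rotating two basis vectors. It is thus the diagonal of the self-adjoint operator in some
orthonormal basis (Horn), and a change of basis is a unitary. So the hull of `finSpectrum` lies in
the numerical range itself, without closure. -/

namespace CNumRange

/-! ### Spectral theorem for compact normal operators -/

section Spectral

universe u

variable {H : Type u} [NormedAddCommGroup H] [InnerProductSpace ℂ H] [CompleteSpace H]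

open Module.End

lemma isStarNormal_sub_smul_one {T : H →L[ℂ] H} (hT : IsStarNormal T) (z : ℂ) :
    IsStarNormal (T - z • (1 : H →L[ℂ] H)) := by
  have h := hT.star_comm_self.eq
  refine ⟨?_⟩
  simp only [Commute, SemiconjBy, star_sub, star_smul, star_one, sub_mul, mul_sub, h,
    smul_mul_assoc, mul_smul_comm, one_mul, mul_one]
  rw [smul_sub, smul_sub, smul_comm]
  abel

/-- The operator T - z is normal, so it has the same kernel as its adjoint. -/
lemma adjoint_apply_of_apply_eq_smul {T : H →L[ℂ] H} (hT : IsStarNormal T) {z : ℂ} {x : H}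
    (hx : T x = z • x) : ContinuousLinearMap.adjoint T x = (starRingEnd ℂ) z • x := by
  have h := (ContinuousLinearMap.IsStarNormal.adjoint_apply_eq_zero_iff
    (isStarNormal_sub_smul_one hT z) x).2 (by simp [hx])
  rw [← ContinuousLinearMap.star_eq_adjoint] at h ⊢
  simpa [sub_eq_zero] using h

lemma orthogonalFamily_eigenspaces {T : H →L[ℂ] H} (hT : IsStarNormal T) :
    OrthogonalFamily ℂ (fun z => eigenspace (T : Module.End ℂ H) z)
      fun z => (eigenspace (T : Module.End ℂ H) z).subtypeₗᵢ := by
  rintro z w hzw ⟨v, hv⟩ ⟨u, hu⟩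
  rw [mem_eigenspace_iff] at hv hu
  have h1 : ⟪ContinuousLinearMap.adjoint T v, u⟫_ℂ = ⟪v, T u⟫_ℂ :=
    ContinuousLinearMap.adjoint_inner_left _ _ _
  have hu' : T u = w • u := hu
  rw [adjoint_apply_of_apply_eq_smul hT hv, hu', inner_smul_left, inner_smul_right,
    Complex.conj_conj, ← sub_eq_zero, ← sub_mul, mul_eq_zero, sub_eq_zero] at h1
  exact h1.resolve_left hzw

/-- For normal N, N²y = 0 gives N†Ny = 0, hence ‖Ny‖² = 0. Algebraic and geometric multiplicities
therefore agree. -/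
lemma maxGenEigenspace_eq_eigenspace {T : H →L[ℂ] H} (hT : IsStarNormal T) (z : ℂ) :
    maxGenEigenspace (T : Module.End ℂ H) z = eigenspace (T : Module.End ℂ H) z := by
  refine le_antisymm (fun x hx => ?_)
    ((genEigenspace (T : Module.End ℂ H) z).monotone le_top)
  obtain ⟨k, hk⟩ := mem_maxGenEigenspace _ _ _ |>.1 hx
  set N : H →L[ℂ] H := T - z • (1 : H →L[ℂ] H) with hN
  have hNn : IsStarNormal N := isStarNormal_sub_smul_one hT z
  have hNk : ∀ k, ((T : Module.End ℂ H) - z • 1) ^ k = ((N : Module.End ℂ H)) ^ k := fun k => by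
    congr 1
  have key : ∀ y, N (N y) = 0 → N y = 0 := fun y hy => by
    have h := (ContinuousLinearMap.IsStarNormal.adjoint_apply_eq_zero_iff hNn (N y)).2 hy
    rw [← inner_self_eq_zero (𝕜 := ℂ), ← ContinuousLinearMap.adjoint_inner_left, h, inner_zero_left]
  have main : ∀ k, ((N : Module.End ℂ H) ^ k) x = 0 → N x = 0 := by
    intro k
    induction k with
    | zero => intro h; simp only [pow_zero, Module.End.one_apply] at h; simp [h]
    | succ k ih =>
      intro h
      cases k with
      | zero => simpa using h
      | succ k =>
        refine ih ?_
        rw [pow_succ', pow_succ'] at h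
        rw [pow_succ']
        exact key _ h
  rw [hNk] at hk
  have := main k hk
  rw [mem_eigenspace_iff]
  simpa [hN, sub_eq_zero] using this

/-- The norm of a normal operator is its spectral radius, and nonzero spectral values of a compact
operator are eigenvalues. -/
lemma eq_zero_of_forall_not_hasEigenvalue {T : H →L[ℂ] H} (hTc : IsCompactOperator T)
    (hT : IsStarNormal T) (h : ∀ z, z ≠ 0 → ¬ HasEigenvalue (T : Module.End ℂ H) z) : T = 0 := by
  have h0 : (‖T‖₊ : ENNReal) = 0 := by
    rw [← IsStarNormal.spectralRadius_eq_nnnorm, spectralRadius, ENNReal.iSup_eq_zero]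
    intro z
    rw [ENNReal.iSup_eq_zero]
    intro hz
    by_contra hne
    have hz0 : z ≠ 0 := by rintro rfl; simp at hne
    exact h z hz0 ((hTc.hasEigenvalue_iff_mem_spectrum hz0).2 hz)
  simpa using h0

/-- The complement W reduces T, and T has no eigenvector in W. The compact normal restriction
therefore vanishes, which would make every nonzero vector of W an eigenvector for 0. -/
lemma orthogonal_iSup_eigenspaces_eq_bot {T : H →L[ℂ] H} (hTc : IsCompactOperator T)
    (hT : IsStarNormal T) : (⨆ z, eigenspace (T : Module.End ℂ H) z)ᗮ = ⊥ := by
  set W : Submodule ℂ H := (⨆ z, eigenspace (T : Module.End ℂ H) z)ᗮ with hW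
  have hmem : ∀ x, x ∈ W ↔ ∀ (z : ℂ) (u : H), T u = z • u → ⟪u, x⟫_ℂ = 0 := by
    intro x
    rw [hW, ← Submodule.iInf_orthogonal, Submodule.mem_iInf]
    simp only [Submodule.mem_orthogonal, mem_eigenspace_iff]
    rfl
  have hinv : ∀ x ∈ W, T x ∈ W := by
    intro x hx
    rw [hmem] at hx ⊢
    intro z u hu
    rw [← ContinuousLinearMap.adjoint_inner_left, adjoint_apply_of_apply_eq_smul hT hu,
      inner_smul_left, hx z u hu, mul_zero]
  have hinv' : ∀ x ∈ W, ContinuousLinearMap.adjoint T x ∈ W := by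
    intro x hx
    rw [hmem] at hx ⊢
    intro z u hu
    rw [ContinuousLinearMap.adjoint_inner_right, hu, inner_smul_left, hx z u hu, mul_zero]
  let S : W →L[ℂ] W := T.restrict hinv
  have hS_compact : IsCompactOperator S := hTc.restrict' hinv
  have hS_adj : ContinuousLinearMap.adjoint S = (ContinuousLinearMap.adjoint T).restrict hinv' := by
    symm
    rw [ContinuousLinearMap.eq_adjoint_iff]
    intro x y
    exact ContinuousLinearMap.adjoint_inner_left T (y : H) (x : H)
  have hS_normal : IsStarNormal S := by
    rw [ContinuousLinearMap.isStarNormal_iff_norm_eq_adjoint]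
    intro v
    rw [hS_adj]
    exact ContinuousLinearMap.isStarNormal_iff_norm_eq_adjoint.1 hT v
  have hS : ∀ (z : ℂ) (v : W), S v = z • v → v = 0 := by
    intro z v hv
    have hv' : T (v : H) = z • (v : H) := congrArg Subtype.val hv
    have := (hmem v).1 v.2 z v hv'
    exact Subtype.ext (inner_self_eq_zero.1 this)
  have hev : ∀ z, ¬ HasEigenvalue (S : Module.End ℂ W) z := by
    intro z h
    obtain ⟨v, hv, hv0⟩ := h.exists_hasEigenvector
    exact hv0 (hS z v (mem_eigenspace_iff.1 hv))
  have hS0 : S = 0 := eq_zero_of_forall_not_hasEigenvalue hS_compact hS_normal fun z _ => hev z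
  rw [Submodule.eq_bot_iff]
  intro x hx
  have := hS 0 ⟨x, hx⟩ (by rw [hS0]; simp)
  exact congrArg Subtype.val this

/-- An infinite-dimensional Hilbert space has uncountable algebraic dimension, even with a countable
Hilbert basis; the two sizes are comparable only after all infinite cardinals are identified. -/
lemma toENat_rank_eq_enatCard {K : Type*} [NormedAddCommGroup K] [InnerProductSpace ℂ K]
    [CompleteSpace K] {ι : Type*} (b : HilbertBasis ι ℂ K) :
    Cardinal.toENat (Module.rank ℂ K) = ENat.card ι := by
  cases finite_or_infinite ι with
  | inl h =>
    have := Fintype.ofFinite ι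
    have hB := b.toOrthonormalBasis.toBasis
    rw [rank_eq_card_basis hB]
    simp
  | inr h =>
    rw [ENat.card_eq_top_of_infinite, Cardinal.toENat_eq_top]
    by_contra hlt
    push Not at hlt
    have := Module.rank_lt_aleph0_iff.1 hlt
    exact (not_finite_iff_infinite.2 h) (b.orthonormal.linearIndependent.finite)

lemma countable_of_hilbertBasis {H : Type*} [NormedAddCommGroup H] [InnerProductSpace ℂ H]
    [TopologicalSpace.SeparableSpace H] {ι : Type*}
    (b : HilbertBasis ι ℂ H) : Countable ι := by
  refine Pairwise.countable_of_isOpen_disjoint (s := fun i => Metric.ball (b i) (1 / 2)) ?_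
    (fun _ => Metric.isOpen_ball) fun i => ⟨b i, by simp⟩
  intro i j hij
  refine Metric.ball_disjoint_ball ?_
  have h : ‖b i - b j‖ ^ 2 = 2 := by
    rw [@norm_sub_sq ℂ, b.orthonormal.1 i, b.orthonormal.1 j, b.orthonormal.2 hij]
    norm_num
  rw [dist_eq_norm]
  nlinarith [norm_nonneg (b i - b j)]

/-- A compact normal operator has a Hilbert basis of eigenvectors, indexed by pairs of an eigenvalue
and an index in a Hilbert basis of the eigenspace. -/
lemma exists_eigenbasis {T : H →L[ℂ] H} (hTc : IsCompactOperator T) (hT : IsStarNormal T) :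
    ∃ (ι : ℂ → Type u) (b : HilbertBasis (Σ z, ι z) ℂ H), (∀ p, T (b p) = p.1 • b p) ∧
      ∀ z, Cardinal.toENat (Module.rank ℂ (eigenspace (T : Module.End ℂ H) z)) =
        ENat.card (ι z) := by
  have hcl : ∀ z, IsClosed (eigenspace (T : Module.End ℂ H) z : Set H) := fun z => by
    have : (eigenspace (T : Module.End ℂ H) z : Set H) = {x | T x = z • x} := by
      ext x; exact mem_eigenspace_iff
    rw [this]
    exact isClosed_eq T.continuous (continuous_const_smul z)
  have hcomp : ∀ z, CompleteSpace (eigenspace (T : Module.End ℂ H) z) := fun z =>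
    (hcl z).completeSpace_coe
  choose w b hb using fun z => exists_hilbertBasis ℂ (eigenspace (T : Module.End ℂ H) z)
  let v : (Σ z, w z) → H := fun p => (b p.1 p.2 : H)
  have hv : Orthonormal ℂ v :=
    (orthogonalFamily_eigenspaces hT).orthonormal_sigma_orthonormal fun z => (b z).orthonormal
  have hsp : (Submodule.span ℂ (range v))ᗮ = ⊥ := by
    rw [eq_bot_iff, ← orthogonal_iSup_eigenspaces_eq_bot hTc hT, ← Submodule.iInf_orthogonal]
    refine le_iInf fun z x hx => ?_
    rw [Submodule.mem_orthogonal] at hx ⊢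
    intro u hu
    have h1 := ((b z).hasSum_repr ⟨u, hu⟩).mapL (eigenspace (T : Module.End ℂ H) z).subtypeL
    have h2 := h1.mapL (innerSL ℂ x)
    have h3 : ⟪x, u⟫_ℂ = 0 := by
      refine h2.unique ?_
      convert hasSum_zero with i
      have := hx (b z i) (Submodule.subset_span ⟨⟨z, i⟩, rfl⟩)
      rw [inner_eq_zero_symm] at this
      simp [this]
    exact inner_eq_zero_symm.1 h3
  refine ⟨fun z => w z, HilbertBasis.mkOfOrthogonalEqBot hv hsp, ?_, ?_⟩
  · intro p
    rw [HilbertBasis.coe_mkOfOrthogonalEqBot]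
    exact mem_eigenspace_iff.1 (b p.1 p.2).2
  · exact fun z => toENat_rank_eq_enatCard (b z)

end Spectral

/-! ### Modified eigenvalue sequences as lists of diagonal entries -/

section EigenvalueSequences

open Module.End

variable {H : Type*} [NormedAddCommGroup H] [InnerProductSpace ℂ H] [CompleteSpace H]

lemma nonempty_equiv_of_enatCard_eq {α β : Type*} [Countable α] [Countable β]
    (h : ENat.card α = ENat.card β) : Nonempty (α ≃ β) := by
  cases finite_or_infinite α with
  | inl hα =>
    have hβ : Finite β := by
      rw [← ENat.card_lt_top, ← h, ENat.card_lt_top]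
      exact hα
    rw [ENat.card_eq_coe_natCard, ENat.card_eq_coe_natCard, Nat.cast_inj] at h
    exact ⟨(Finite.card_eq.1 h).some⟩
  | inr hα =>
    have hβ : Infinite β := by
      rw [← ENat.card_eq_top, ← h, ENat.card_eq_top]
      exact hα
    exact nonempty_equiv_of_countable

lemma exists_hilbertBasis_comp_equiv {ι κ : Type*} (b : HilbertBasis ι ℂ H) (e : κ ≃ ι) :
    ∃ f : HilbertBasis κ ℂ H, ∀ k, f k = b (e k) := by
  refine ⟨HilbertBasis.mk (v := b ∘ e) (b.orthonormal.comp e e.injective) ?_, fun k => ?_⟩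
  · rw [e.surjective.range_comp, b.dense_span]
  · rw [HilbertBasis.coe_mk]; rfl

omit [CompleteSpace H] in
lemma infinite_of_hilbertBasis (hdim : ¬ FiniteDimensional ℂ H) {ι : Type*}
    (b : HilbertBasis ι ℂ H) : Infinite ι := by
  by_contra h
  rw [not_infinite_iff_finite] at h
  have := Fintype.ofFinite ι
  exact hdim (Module.Finite.of_basis b.toOrthonormalBasis.toBasis)

variable [TopologicalSpace.SeparableSpace H]

/-- Every compact normal operator has a modified eigenvalue sequence. -/
theorem exists_isModifiedEigenvalueSeq (hdim : ¬ FiniteDimensional ℂ H) {T : H →L[ℂ] H}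
    (hTc : IsCompactOperator T) (hT : IsStarNormal T) :
    ∃ τ : ℕ → ℂ, IsModifiedEigenvalueSeq T τ := by
  obtain ⟨ι, b, hb, hι⟩ := exists_eigenbasis hTc hT
  have := infinite_of_hilbertBasis hdim b
  have := countable_of_hilbertBasis b
  obtain ⟨e⟩ : Nonempty (ℕ ≃ Σ z, ι z) := nonempty_equiv_of_countable
  have key : ∀ z, {n | (e n).1 = z}.encard =
      Cardinal.toENat (Module.rank ℂ (eigenspace (T : Module.End ℂ H) z)) := by
    intro z
    rw [hι z]
    exact ENat.card_congr ((e.subtypeEquiv fun n => Iff.rfl).trans (Equiv.sigmaSubtype z))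
  refine ⟨fun n => (e n).1, fun z _ => ?_, fun _ => ?_⟩
  · rw [maxGenEigenspace_eq_eigenspace hT]
    exact key z
  · rw [key 0, eigenspace_zero]

/-- A modified eigenvalue sequence of a compact normal operator lists the eigenvalues belonging to
some Hilbert basis of eigenvectors. -/
theorem IsModifiedEigenvalueSeq.exists_eigenbasis (hdim : ¬ FiniteDimensional ℂ H)
    {T : H →L[ℂ] H} (hTc : IsCompactOperator T) (hT : IsStarNormal T) {τ : ℕ → ℂ}
    (hτ : IsModifiedEigenvalueSeq T τ) :
    ∃ f : HilbertBasis ℕ ℂ H, ∀ n, T (f n) = τ n • f n := by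
  obtain ⟨ι, b, hb, hι⟩ := CNumRange.exists_eigenbasis hTc hT
  have hinf := infinite_of_hilbertBasis hdim b
  have := countable_of_hilbertBasis b
  have hcount : ∀ z, Countable (ι z) := fun z =>
    Function.Injective.countable (f := fun i => (⟨z, i⟩ : Σ z, ι z)) sigma_mk_injective
  have hne : ∀ z, z ≠ 0 → Nonempty ({n // τ n = z} ≃ ι z) := by
    intro z hz
    refine nonempty_equiv_of_enatCard_eq ?_
    have := hτ.encard_ne_zero z hz
    rw [maxGenEigenspace_eq_eigenspace hT, hι z] at this
    exact this
  have h0 : Nonempty ({n // τ n = 0} ≃ ι 0) := by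
    refine nonempty_equiv_of_enatCard_eq ?_
    by_cases hfin : {n | τ n ≠ 0}.Infinite
    · have := hτ.encard_zero hfin
      rw [← eigenspace_zero, hι 0] at this
      exact this
    · rw [not_infinite] at hfin
      have h1 : Infinite {n // τ n = 0} := by
        have h : {n | τ n ≠ 0}ᶜ.Infinite := hfin.infinite_compl
        have h' : {n | τ n = 0}.Infinite := by
          convert h using 1
          ext n
          simp
        exact h'.to_subtype
      -- Nonzero eigenvalues use up only finitely many basis vectors, so a finite kernel part would
      -- make the whole basis finite.
      have h2 : Infinite (ι 0) := by
        by_contra hι0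
        rw [not_infinite_iff_finite] at hι0
        have hfin' := hfin.to_subtype
        let g : ∀ z, z ≠ 0 → ({n // τ n = z} ≃ ι z) := fun z hz => (hne z hz).some
        let F : {p : Σ z, ι z // p.1 ≠ 0} → {n | τ n ≠ 0} := fun p =>
          ⟨((g p.1.1 p.2).symm p.1.2).1, by
            rw [mem_ofPred_eq, ((g p.1.1 p.2).symm p.1.2).2]
            exact p.2⟩
        have hF : Function.Injective F := by
          rintro ⟨⟨z, i⟩, hz⟩ ⟨⟨w, j⟩, hw⟩ h
          have h' : ((g z hz).symm i).1 = ((g w hw).symm j).1 := congrArg Subtype.val h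
          obtain rfl : z = w := by
            rw [← ((g z hz).symm i).2, h', ((g w hw).symm j).2]
          have := (g z hz).symm.injective (Subtype.ext h')
          rw [this]
        have h3 : Finite {p : Σ z, ι z // p.1 ≠ 0} := Finite.of_injective F hF
        have h4 : Finite {p : Σ z, ι z // p.1 = 0} := Finite.of_equiv _ (Equiv.sigmaSubtype (β := ι) 0).symm
        exact not_finite_iff_infinite.2 hinf
          (Finite.of_equiv _ (Equiv.sumCompl fun p : Σ z, ι z => p.1 = 0))
      rw [ENat.card_eq_top_of_infinite, ENat.card_eq_top_of_infinite]
  have hall : ∀ z, Nonempty ({n // τ n = z} ≃ ι z) := fun z => by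
    by_cases hz : z = 0
    · rw [hz]; exact h0
    · exact hne z hz
  let e : ℕ ≃ Σ z, ι z := (Equiv.sigmaFiberEquiv τ).symm.trans
    (Equiv.sigmaCongrRight fun z => (hall z).some)
  obtain ⟨f, hf⟩ := exists_hilbertBasis_comp_equiv b e
  refine ⟨f, fun n => ?_⟩
  rw [hf n, hb]
  rfl

omit [TopologicalSpace.SeparableSpace H] in
-- By Bessel, fₙ tends weakly to 0, hence so does T fₙ; compactness gives norm-convergent
-- subsequences, whose limits can only be 0.
lemma tendsto_eigenvalues_zero {T : H →L[ℂ] H} (hTc : IsCompactOperator T) {τ : ℕ → ℂ}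
    {f : ℕ → H} (hf : Orthonormal ℂ f) (hTf : ∀ n, T (f n) = τ n • f n) :
    Tendsto τ atTop (𝓝 0) := by
  obtain ⟨K, hK, hsub⟩ := hTc.image_closedBall_subset_compact (f := (T : H →ₗ[ℂ] H)) 1
  have hmem : ∀ n, T (f n) ∈ K := fun n =>
    hsub ⟨f n, by simp [hf.1 n], rfl⟩
  have key : Tendsto (fun n => T (f n)) atTop (𝓝 0) := by
    refine tendsto_of_subseq_tendsto fun ns hns => ?_
    obtain ⟨v, -, φ, hφ, hlim⟩ := hK.tendsto_subseq fun n => hmem (ns n)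
    refine ⟨φ, ?_⟩
    have h1 : Tendsto (fun n => ⟪v, T (f (ns (φ n)))⟫_ℂ) atTop (𝓝 ⟪v, v⟫_ℂ) :=
      tendsto_const_nhds.inner hlim
    have h2 : Tendsto (fun n => ⟪f n, ContinuousLinearMap.adjoint T v⟫_ℂ) atTop (𝓝 0) := by
      have := (hf.inner_products_summable (ContinuousLinearMap.adjoint T v)).tendsto_atTop_zero
      rw [tendsto_zero_iff_norm_tendsto_zero]
      have h3 := this.sqrt
      simpa using h3
    have h3 : Tendsto (fun n => ⟪v, T (f (ns (φ n)))⟫_ℂ) atTop (𝓝 0) := by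
      have h4 := (h2.comp (hns.comp hφ.tendsto_atTop)).star
      rw [star_zero] at h4
      refine h4.congr fun n => ?_
      simp only [Function.comp_apply, RCLike.star_def, inner_conj_symm]
      rw [ContinuousLinearMap.adjoint_inner_left]
    have hv : v = 0 := inner_self_eq_zero.1 (tendsto_nhds_unique h1 h3)
    rw [← hv]
    exact hlim
  rw [tendsto_zero_iff_norm_tendsto_zero] at key ⊢
  refine key.congr fun n => ?_
  rw [hTf, norm_smul, hf.1 n, mul_one]

omit [TopologicalSpace.SeparableSpace H] in
-- The γₙ are the diagonal entries of C · 1 in the basis e, and the trace series converges in every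
-- basis.
lemma summable_of_isTraceClass {C : H →L[ℂ] H} (hC : IsTraceClass C) {γ : ℕ → ℂ}
    {e : HilbertBasis ℕ ℂ H} (he : ∀ n, C (e n) = γ n • e n) : Summable γ := by
  have h := (hC.hasSum_opTrace_mul 1 e).summable
  refine h.congr fun n => ?_
  simp [he n, inner_self_eq_norm_sq_to_K, e.orthonormal.1 n]

end EigenvalueSequences

/-! ### Majorization and the Hardy–Littlewood–Pólya theorem -/

section Majorization

/-- `y` is majorized by `x` on the finite set `s` of indices. -/
def MajorizedOn {ι : Type*} (s : Finset ι) (y x : ι → ℝ) : Prop :=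
  (∀ A ⊆ s, ∀ c, ∑ n ∈ A, (y n - c) ≤ ∑ n ∈ s, max (x n - c) 0) ∧ ∑ n ∈ s, y n = ∑ n ∈ s, x n

variable {ι : Type*}

lemma sum_sub_const_le_sum_max {A s : Finset ι} (hA : A ⊆ s) (x : ι → ℝ) (c : ℝ) :
    ∑ n ∈ A, (x n - c) ≤ ∑ n ∈ s, max (x n - c) 0 :=
  (Finset.sum_le_sum fun _ _ => le_max_left _ _).trans
    (Finset.sum_le_sum_of_subset_of_nonneg hA fun _ _ _ => le_max_right _ _)

variable [DecidableEq ι]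

/-- Allows two finite modifications of x to be compared on a common index set. -/
lemma MajorizedOn.mono {s t : Finset ι} {y x : ι → ℝ} (h : MajorizedOn s y x)
    (hyx : ∀ n, n ∉ s → y n = x n) (hst : s ⊆ t) : MajorizedOn t y x := by
  refine ⟨fun A hA c => ?_, ?_⟩
  · rw [← Finset.sum_sdiff hst, ← Finset.sum_inter_add_sum_sdiff A s, add_comm]
    refine add_le_add ?_ (h.1 _ Finset.inter_subset_right c)
    rw [Finset.sum_congr rfl fun n hn => by rw [hyx n (Finset.mem_sdiff.1 hn).2]]
    exact sum_sub_const_le_sum_max (Finset.sdiff_subset_sdiff hA le_rfl) x c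
  · rw [← Finset.sum_sdiff hst, ← Finset.sum_sdiff hst, h.2,
      Finset.sum_congr rfl fun n hn => hyx n (Finset.mem_sdiff.1 hn).2]

lemma majorizedOn_comp_perm {s : Finset ι} (x : ι → ℝ) (π : Equiv.Perm ι)
    (hπ : ∀ n, n ∉ s → π n = n) : MajorizedOn s (fun n => x (π n)) x := by
  have hs : {n | π n ≠ n} ⊆ (s : Set ι) := fun n hn => by
    by_contra h
    exact hn (hπ n h)
  refine ⟨fun A hA c => ?_, π.sum_comp s x hs⟩
  rw [← π.sum_comp s (fun n => max (x n - c) 0) hs]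
  exact sum_sub_const_le_sum_max hA (fun n => x (π n)) c

omit [DecidableEq ι] in
-- Stated through positive parts of x - c, the conditions are linear in y and need no sorting, so
-- they survive convex combinations.
lemma convex_majorizedOn (s : Finset ι) (x : ι → ℝ) : Convex ℝ {y | MajorizedOn s y x} := by
  rintro y ⟨hy, hy'⟩ z ⟨hz, hz'⟩ a b ha hb hab
  refine ⟨fun A hA c => ?_, ?_⟩
  · have h : ∑ n ∈ A, ((a • y + b • z) n - c) =
        a * ∑ n ∈ A, (y n - c) + b * ∑ n ∈ A, (z n - c) := by
      rw [Finset.mul_sum, Finset.mul_sum, ← Finset.sum_add_distrib]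
      refine Finset.sum_congr rfl fun n _ => ?_
      simp only [Pi.add_apply, Pi.smul_apply, smul_eq_mul]
      linear_combination c * hab
    rw [h]
    have h1 := mul_le_mul_of_nonneg_left (hy A hA c) ha
    have h2 := mul_le_mul_of_nonneg_left (hz A hA c) hb
    calc _ ≤ a * ∑ n ∈ s, max (x n - c) 0 + b * ∑ n ∈ s, max (x n - c) 0 := add_le_add h1 h2
      _ = _ := by rw [← add_mul, hab, one_mul]
  · simp only [Pi.add_apply, Pi.smul_apply, smul_eq_mul, Finset.sum_add_distrib,
      ← Finset.mul_sum, hy', hz', ← add_mul, hab, one_mul]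

/-- Averaging of two coordinates. -/
def averagePair (x : ι → ℝ) (i j : ι) (t : ℝ) : ι → ℝ :=
  Function.update (Function.update x i (t * x i + (1 - t) * x j)) j ((1 - t) * x i + t * x j)

lemma averagePair_left {x : ι → ℝ} {i j : ι} (hij : i ≠ j) (t : ℝ) :
    averagePair x i j t i = t * x i + (1 - t) * x j := by
  simp [averagePair, hij]

lemma averagePair_right {x : ι → ℝ} {i j : ι} (t : ℝ) :
    averagePair x i j t j = (1 - t) * x i + t * x j := by
  simp [averagePair]

lemma averagePair_of_ne {x : ι → ℝ} {i j n : ι} (hi : n ≠ i) (hj : n ≠ j) (t : ℝ) :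
    averagePair x i j t n = x n := by
  simp [averagePair, hi, hj]

/-- Closure under averaging thus includes closure under transpositions. -/
lemma averagePair_zero {x : ι → ℝ} {i j : ι} (hij : i ≠ j) :
    averagePair x i j 0 = x ∘ Equiv.swap i j := by
  funext n
  by_cases hi : n = i
  · subst hi; simp [averagePair_left hij]
  by_cases hj : n = j
  · subst hj; simp [averagePair_right]
  simp [averagePair_of_ne hi hj, Equiv.swap_apply_of_ne_of_ne hi hj]

lemma sum_averagePair {s : Finset ι} {i j : ι} (hi : i ∈ s) (hj : j ∈ s) (hij : i ≠ j)
    (x : ι → ℝ) (t : ℝ) (g : ℝ → ℝ) :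
    ∑ n ∈ s, g (averagePair x i j t n) = ∑ n ∈ s, g (x n) - g (x i) - g (x j) +
      g (t * x i + (1 - t) * x j) + g ((1 - t) * x i + t * x j) := by
  have hj' : j ∈ s.erase i := Finset.mem_erase.2 ⟨hij.symm, hj⟩
  rw [← Finset.add_sum_erase _ _ hi, ← Finset.add_sum_erase _ _ hj',
    ← Finset.add_sum_erase s (fun n => g (x n)) hi, ← Finset.add_sum_erase _ (fun n => g (x n)) hj',
    averagePair_left hij, averagePair_right]
  have : ∑ n ∈ (s.erase i).erase j, g (averagePair x i j t n) =
      ∑ n ∈ (s.erase i).erase j, g (x n) := by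
    refine Finset.sum_congr rfl fun n hn => ?_
    simp only [Finset.mem_erase] at hn
    rw [averagePair_of_ne hn.2.1 hn.1]
  rw [this]
  ring

/-- Pulling two neighbouring coordinates of `x` together until one of them equals `y i` keeps the
other coordinates of `y` majorized. -/
lemma MajorizedOn.erase_of_between {s : Finset ι} {y x x' : ι → ℝ} (h : MajorizedOn s y x)
    {i p q : ι} (hi : i ∈ s) (hp : p ∈ s) (hpy : y i ≤ x p) (hqy : x q ≤ y i)
    (hgap : ∀ n ∈ s, x p ≤ x n ∨ x n ≤ x q)
    (hx' : ∀ g : ℝ → ℝ, ∑ n ∈ s.erase i, g (x' n) =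
      ∑ n ∈ s, g (x n) - g (x p) - g (x q) + g (x p + x q - y i)) :
    MajorizedOn (s.erase i) y x' := by
  have hqp : x q ≤ x p := hqy.trans hpy
  refine ⟨fun A hA c => ?_, ?_⟩
  · rw [hx' fun u => max (u - c) 0]
    have hAs : A ⊆ s := hA.trans (Finset.erase_subset _ _)
    have hiA : i ∉ A := fun hiA => Finset.notMem_erase i s (hA hiA)
    have hiAs : insert i A ⊆ s := Finset.insert_subset hi hAs
    set m := x p + x q - y i with hm
    -- For c outside (x q, x p) the three changed positive parts are all linear or all zero, and
    -- majorization at c suffices.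
    rcases le_or_gt c (x q) with hcq | hcq
    · have h1 := h.1 (insert i A) hiAs c
      rw [Finset.sum_insert hiA] at h1
      rw [max_eq_left (a := x p - c) (by linarith), max_eq_left (a := x q - c) (by linarith),
        max_eq_left (a := m - c) (by linarith)]
      linarith
    rcases le_or_gt (x p) c with hcp | hcp
    · have h1 := h.1 A hAs c
      rw [max_eq_right (a := x p - c) (by linarith), max_eq_right (a := x q - c) (by linarith),
        max_eq_right (a := m - c) (by linarith)]
      linarith
    -- Between x q and x p the sum of positive parts is affine in the threshold with slope -|G|. The
    -- bound is transported from the endpoint x p if |A| < |G|, and from x q with i adjoined to A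
    -- otherwise.
    set G := s.filter fun n => x p ≤ x n with hG
    have hpG : p ∈ G := Finset.mem_filter.2 ⟨hp, le_rfl⟩
    have hsum : ∀ d, x q ≤ d → d ≤ x p →
        ∑ n ∈ s, max (x n - d) 0 = ∑ n ∈ G, x n - G.card * d := by
      intro d hd1 hd2
      rw [← nsmul_eq_mul, ← Finset.sum_const, ← Finset.sum_sub_distrib, hG, Finset.sum_filter]
      refine Finset.sum_congr rfl fun n hn => ?_
      split_ifs with hn'
      · exact max_eq_left (by linarith)
      · exact max_eq_right (by linarith [(hgap n hn).resolve_left hn'])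
    have hcount : ∀ (B : Finset ι) (d : ℝ), ∑ n ∈ B, (y n - d) = ∑ n ∈ B, y n - B.card * d := by
      intro B d
      rw [Finset.sum_sub_distrib, Finset.sum_const, nsmul_eq_mul]
    rw [hsum c hcq.le hcp.le, max_eq_left (a := x p - c) (by linarith),
      max_eq_right (a := x q - c) (by linarith), hcount]
    rcases lt_or_ge A.card G.card with hlt | hge
    · have h1 := h.1 A hAs (x p)
      rw [hcount, hsum _ hqp le_rfl] at h1
      have h2 : (A.card : ℝ) + 1 ≤ G.card := by exact_mod_cast hlt
      have h3 : 0 ≤ ((G.card : ℝ) - A.card - 1) * (x p - c) :=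
        mul_nonneg (by linarith) (by linarith)
      have h4 := le_max_right (m - c) 0
      nlinarith
    · have h1 := h.1 (insert i A) hiAs (x q)
      rw [hcount, hsum _ le_rfl hqp, Finset.sum_insert hiA, Finset.card_insert_of_notMem hiA] at h1
      push_cast at h1
      have h2 : (G.card : ℝ) ≤ A.card := by exact_mod_cast hge
      have h3 : 0 ≤ ((A.card : ℝ) - G.card) * (c - x q) :=
        mul_nonneg (by linarith) (by linarith)
      have h4 := le_max_left (m - c) 0
      nlinarith
  · have h1 := hx' id
    have h2 := Finset.add_sum_erase s y hi
    have h3 := h.2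
    simp only [id] at h1
    linarith

/-- **Hardy–Littlewood–Pólya**: a set of vectors closed under averaging pairs of coordinates
contains, with `x`, all vectors majorized by `x`. -/
theorem MajorizedOn.induction {P : (ι → ℝ) → Prop}
    (hP : ∀ x, P x → ∀ i j, i ≠ j → ∀ t, 0 ≤ t → t ≤ 1 → P (averagePair x i j t))
    (s : Finset ι) : ∀ {x y : ι → ℝ}, MajorizedOn s y x → (∀ n, n ∉ s → y n = x n) →
      P x → P y := by
  have hswap : ∀ x, P x → ∀ i j, P (x ∘ Equiv.swap i j) := by
    intro x hx i j
    by_cases hij : i = j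
    · subst hij; simpa using hx
    · rw [← averagePair_zero hij]
      exact hP x hx i j hij 0 le_rfl zero_le_one
  induction s using Finset.strongInduction with
  | H s ih =>
    intro x y hmaj hyx hPx
    obtain rfl | ⟨i, hi⟩ := s.eq_empty_or_nonempty
    · have : y = x := funext fun n => hyx n (Finset.notMem_empty n)
      rwa [this]
    -- reduction to a vector `x₁` having the entry `y i` at some place `p ∈ s`
    have key : ∀ x₁ : ι → ℝ, P x₁ → (∀ n, n ∉ s → x₁ n = x n) → ∀ p ∈ s, x₁ p = y i →
        MajorizedOn (s.erase i) y (x₁ ∘ Equiv.swap p i) → P y := by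
      intro x₁ h1 h2 p hp h3 h4
      refine ih _ (Finset.erase_ssubset hi) h4 (fun n hn => ?_) (hswap x₁ h1 p i)
      by_cases hni : n = i
      · subst hni; simp [h3]
      · have hns : n ∉ s := fun h => hn (Finset.mem_erase.2 ⟨hni, h⟩)
        have hnp : n ≠ p := fun h => hns (h ▸ hp)
        rw [Function.comp_apply, Equiv.swap_apply_of_ne_of_ne hnp hni, h2 n hns, hyx n hns]
    have hsumswap : ∀ (x₁ : ι → ℝ) (p : ι), p ∈ s → x₁ p = y i → ∀ g : ℝ → ℝ,
        ∑ n ∈ s.erase i, g ((x₁ ∘ Equiv.swap p i) n) = ∑ n ∈ s, g (x₁ n) - g (y i) := by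
      intro x₁ p hp h g
      have h1 := (Equiv.swap p i).sum_comp s (fun n => g (x₁ n)) (fun n hn => by
        rcases (Equiv.swap_apply_ne_self_iff.1 hn).2 with rfl | rfl <;> assumption)
      have h2 := Finset.add_sum_erase s (fun n => g ((x₁ ∘ Equiv.swap p i) n)) hi
      simp only [Function.comp_apply, Equiv.swap_apply_right, h] at h1 h2 ⊢
      linarith
    by_cases hex : ∃ p ∈ s, x p = y i
    · obtain ⟨p, hp, hpe⟩ := hex
      refine key x hPx (fun _ _ => rfl) p hp hpe ?_
      -- Here p serves as both neighbours: x p + x p - y i = x p, so the value is removed only once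
      -- on balance.
      exact hmaj.erase_of_between hi hp hpe.ge hpe.le (fun n _ => le_total _ _) fun g => by
        rw [hsumswap x p hp hpe g, hpe]; ring_nf
    · push Not at hex
      -- Testing majorization on {i} at the maximum of x, and below on the complement of i at the
      -- minimum, shows that y i lies within the range of x.
      have hup : (s.filter fun n => y i < x n).Nonempty := by
        by_contra hemp
        rw [Finset.not_nonempty_iff_eq_empty, Finset.filter_eq_empty_iff] at hemp
        obtain ⟨p, hp, hpmax⟩ := s.exists_max_image x ⟨i, hi⟩
        have h1 := hmaj.1 {i} (Finset.singleton_subset_iff.2 hi) (x p)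
        rw [Finset.sum_singleton, Finset.sum_eq_zero fun n hn =>
          max_eq_right (by linarith [hpmax n hn])] at h1
        exact hex p hp (le_antisymm (not_lt.1 (hemp hp)) (by linarith))
      have hdown : (s.filter fun n => x n < y i).Nonempty := by
        by_contra hemp
        rw [Finset.not_nonempty_iff_eq_empty, Finset.filter_eq_empty_iff] at hemp
        obtain ⟨p, hp, hpmin⟩ := s.exists_min_image x ⟨i, hi⟩
        have h1 := hmaj.1 (s.erase i) (Finset.erase_subset _ _) (x p)
        rw [Finset.sum_congr rfl fun n hn =>
          max_eq_left (a := x n - x p) (b := 0) (by linarith [hpmin n hn])] at h1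
        have h2 := Finset.add_sum_erase s (fun n => y n - x p) hi
        have h3 : ∑ n ∈ s, (y n - x p) = ∑ n ∈ s, (x n - x p) := by
          rw [Finset.sum_sub_distrib, Finset.sum_sub_distrib, hmaj.2]
        exact hex p hp (le_antisymm (by linarith) (not_lt.1 (hemp hp)))
      obtain ⟨p, hp, hpmin⟩ := Finset.exists_min_image _ x hup
      obtain ⟨q, hq, hqmax⟩ := Finset.exists_max_image _ x hdown
      rw [Finset.mem_filter] at hp hq
      have hpq : p ≠ q := by rintro rfl; linarith [hp.2, hq.2]
      have hgap : ∀ n ∈ s, x p ≤ x n ∨ x n ≤ x q := by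
        intro n hn
        rcases lt_or_gt_of_ne (hex n hn) with h | h
        · exact Or.inr (hqmax n (Finset.mem_filter.2 ⟨hn, h⟩))
        · exact Or.inl (hpmin n (Finset.mem_filter.2 ⟨hn, h⟩))
      have hd : 0 < x p - x q := by linarith [hp.2, hq.2]
      -- The weight for which averaging the nearest values above and below puts y i at p.
      set t := (y i - x q) / (x p - x q) with ht
      have htd : t * (x p - x q) = y i - x q := div_mul_cancel₀ _ hd.ne'
      have e1 : t * x p + (1 - t) * x q = y i := by linarith
      have e2 : (1 - t) * x p + t * x q = x p + x q - y i := by linarith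
      have hx₁p : averagePair x p q t p = y i := by rw [averagePair_left hpq, e1]
      refine key (averagePair x p q t) (hP x hPx p q hpq t
        (div_nonneg (by linarith [hq.2]) hd.le) ((div_le_one hd).2 (by linarith [hp.2])))
        (fun n hn => averagePair_of_ne (fun h => hn (by rw [h]; exact hp.1))
          (fun h => hn (by rw [h]; exact hq.1)) t)
        p hp.1 hx₁p ?_
      refine hmaj.erase_of_between hi hp.1 hp.2.le hq.2.le hgap fun g => ?_
      rw [hsumswap _ p hp.1 hx₁p g, sum_averagePair hp.1 hq.1 hpq, e1, e2]
      ring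

end Majorization

/-! ### Rotations of a basis and Horn's theorem -/

section Rotation

variable {H : Type*} [NormedAddCommGroup H] [InnerProductSpace ℂ H] [CompleteSpace H]

omit [CompleteSpace H] in
lemma HilbertBasis.eq_zero_of_inner_eq_zero {ι : Type*} (b : HilbertBasis ι ℂ H) {x : H}
    (h : ∀ i, ⟪b i, x⟫_ℂ = 0) : x = 0 := by
  have h1 := b.hasSum_repr x
  simp only [b.repr_apply_apply, h, zero_smul] at h1
  exact h1.unique hasSum_zero

/-- Multiplying one basis vector by μ makes the off-diagonal entry imaginary, so that the cross
terms of a rotation cancel on the diagonal. -/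
lemma exists_phase (w : ℂ) : ∃ μ : ℂ, ‖μ‖ = 1 ∧ (μ * w).re = 0 := by
  by_cases hw : w = 0
  · exact ⟨1, by simp, by simp [hw]⟩
  · refine ⟨Complex.I * (starRingEnd ℂ w / ‖w‖), ?_, ?_⟩
    · have : ‖w‖ ≠ 0 := norm_ne_zero_iff.2 hw
      simp [this]
    · have : Complex.I * (starRingEnd ℂ w / ‖w‖) * w =
          Complex.I * ((Complex.normSq w / ‖w‖ : ℝ) : ℂ) := by
        rw [Complex.ofReal_div, Complex.normSq_eq_conj_mul_self]; ring
      rw [this, Complex.I_mul_re, Complex.ofReal_im, neg_zero]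

/-- Rotating two vectors of a Hilbert basis averages the corresponding diagonal entries of a
symmetric operator. -/
lemma exists_hilbertBasis_diag_averagePair {ι : Type*} [DecidableEq ι] {A : H →L[ℂ] H}
    (hA : (A : H →ₗ[ℂ] H).IsSymmetric) (b : HilbertBasis ι ℂ H) {x : ι → ℝ}
    (hb : ∀ n, ⟪b n, A (b n)⟫_ℂ = x n) {i j : ι} (hij : i ≠ j) {t : ℝ} (ht0 : 0 ≤ t)
    (ht1 : t ≤ 1) :
    ∃ f : HilbertBasis ι ℂ H, ∀ n, ⟪f n, A (f n)⟫_ℂ = averagePair x i j t n := by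
  obtain ⟨μ, hμ, hμw⟩ := exists_phase ⟪b i, A (b j)⟫_ℂ
  set w := ⟪b i, A (b j)⟫_ℂ with hw
  have hw' : ⟪b j, A (b i)⟫_ℂ = starRingEnd ℂ w := by
    rw [hw, inner_conj_symm]; exact (hA (b j) (b i)).symm
  have hμμ : starRingEnd ℂ μ * μ = 1 := by
    rw [← Complex.normSq_eq_conj_mul_self, Complex.normSq_eq_norm_sq, hμ]; simp
  have hcross : μ * w + starRingEnd ℂ μ * starRingEnd ℂ w = 0 := by
    rw [← map_mul, Complex.add_conj, hμw]; simp
  -- Cosine and sine of the rotation angle, so that their squares are the averaging weights.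
  set c := Real.sqrt t with hc
  set d := Real.sqrt (1 - t) with hd
  have hcc : (c : ℂ) * c = t := by
    rw [← Complex.ofReal_mul, Real.mul_self_sqrt ht0]
  have hdd : (d : ℂ) * d = 1 - t := by
    rw [← Complex.ofReal_mul, Real.mul_self_sqrt (by linarith)]; simp
  set v : ι → H := Function.update (Function.update b i ((c : ℂ) • b i + ((d : ℂ) * μ) • b j)) j
    ((-(d : ℂ)) • b i + ((c : ℂ) * μ) • b j) with hv
  have hvi : v i = (c : ℂ) • b i + ((d : ℂ) * μ) • b j := by simp [hv, hij]
  have hvj : v j = (-(d : ℂ)) • b i + ((c : ℂ) * μ) • b j := by simp [hv]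
  have hvn : ∀ n, n ≠ i → n ≠ j → v n = b n := fun n h1 h2 => by simp [hv, h1, h2]
  have hbb := orthonormal_iff_ite.1 b.orthonormal
  have hortho : Orthonormal ℂ v := by
    rw [orthonormal_iff_ite]
    have h1 : ⟪v i, v i⟫_ℂ = 1 := by
      rw [hvi]
      simp only [inner_add_left, inner_add_right, inner_smul_left, inner_smul_right, hbb, hij,
        hij.symm, if_true, if_false, map_mul, Complex.conj_ofReal]
      linear_combination hcc + (d : ℂ) * d * hμμ + hdd
    have h2 : ⟪v j, v j⟫_ℂ = 1 := by
      rw [hvj]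
      simp only [inner_add_left, inner_add_right, inner_smul_left, inner_smul_right, hbb, hij,
        hij.symm, if_true, if_false, map_mul, map_neg, Complex.conj_ofReal]
      linear_combination hcc + (c : ℂ) * c * hμμ + hdd
    have h3 : ⟪v i, v j⟫_ℂ = 0 := by
      rw [hvi, hvj]
      simp only [inner_add_left, inner_add_right, inner_smul_left, inner_smul_right, hbb, hij,
        hij.symm, if_true, if_false, map_mul, Complex.conj_ofReal]
      linear_combination (c : ℂ) * d * hμμ
    have h4 : ∀ n, n ≠ i → n ≠ j → ⟪v i, v n⟫_ℂ = 0 ∧ ⟪v j, v n⟫_ℂ = 0 := fun n hni hnj => by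
      rw [hvi, hvj, hvn n hni hnj]
      simp only [inner_add_left, inner_smul_left, hbb, hni.symm, hnj.symm, if_false, mul_zero,
        add_zero, and_self]
    intro m n
    by_cases hmi : m = i
    · by_cases hni : n = i
      · rw [hmi, hni, h1, if_pos rfl]
      by_cases hnj : n = j
      · rw [hmi, hnj, h3, if_neg hij]
      · rw [hmi, (h4 n hni hnj).1, if_neg (Ne.symm hni)]
    by_cases hmj : m = j
    · by_cases hni : n = i
      · rw [hmj, hni, if_neg hij.symm, inner_eq_zero_symm, h3]
      by_cases hnj : n = j
      · rw [hmj, hnj, h2, if_pos rfl]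
      · rw [hmj, (h4 n hni hnj).2, if_neg (Ne.symm hnj)]
    by_cases hni : n = i
    · rw [hni, if_neg hmi, inner_eq_zero_symm, (h4 m hmi hmj).1]
    by_cases hnj : n = j
    · rw [hnj, if_neg hmj, inner_eq_zero_symm, (h4 m hmi hmj).2]
    · rw [hvn m hmi hmj, hvn n hni hnj, hbb]
  have hbi : b i = (c : ℂ) • v i + (-(d : ℂ)) • v j := by
    rw [hvi, hvj]
    simp only [smul_add, smul_smul]
    match_scalars
    · linear_combination -hcc - hdd
    · ring
  have hbj : b j = starRingEnd ℂ μ • ((d : ℂ) • v i + (c : ℂ) • v j) := by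
    rw [hvi, hvj]
    simp only [smul_add, smul_smul]
    match_scalars
    · linear_combination -hμμ - starRingEnd ℂ μ * μ * (hcc + hdd)
    · ring
  have hspan : (Submodule.span ℂ (range v))ᗮ = ⊥ := by
    rw [Submodule.eq_bot_iff]
    intro z hz
    rw [Submodule.mem_orthogonal] at hz
    have hz' : ∀ n, ⟪v n, z⟫_ℂ = 0 := fun n => hz _ (Submodule.subset_span ⟨n, rfl⟩)
    refine HilbertBasis.eq_zero_of_inner_eq_zero b fun n => ?_
    by_cases hni : n = i
    · rw [hni, hbi]; simp only [inner_add_left, inner_smul_left, hz', mul_zero, add_zero]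
    by_cases hnj : n = j
    · rw [hnj, hbj]; simp only [inner_add_left, inner_smul_left, hz', mul_zero, add_zero]
    · rw [← hvn n hni hnj, hz']
  refine ⟨HilbertBasis.mkOfOrthogonalEqBot hortho hspan, fun n => ?_⟩
  rw [HilbertBasis.coe_mkOfOrthogonalEqBot]
  by_cases hni : n = i
  · rw [hni, averagePair_left hij, hvi]
    simp only [map_add, map_smul, inner_add_left, inner_add_right, inner_smul_left,
      inner_smul_right, hb, hw', ← hw, map_mul, Complex.conj_ofReal]
    push_cast
    linear_combination (x i : ℂ) * hcc + (x j : ℂ) * d * d * hμμ + (x j : ℂ) * hdd +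
      (c : ℂ) * d * hcross
  by_cases hnj : n = j
  · rw [hnj, averagePair_right, hvj]
    simp only [map_add, map_smul, inner_add_left, inner_add_right, inner_smul_left,
      inner_smul_right, hb, hw', ← hw, map_mul, map_neg, Complex.conj_ofReal]
    push_cast
    linear_combination (x j : ℂ) * hcc + (x j : ℂ) * c * c * hμμ + (x i : ℂ) * hdd -
      (c : ℂ) * d * hcross
  · rw [averagePair_of_ne hni hnj, hvn n hni hnj, hb]

/-- **Horn's theorem** for finitely many entries: a sequence majorized by the diagonal of a symmetric
operator in some Hilbert basis is its diagonal in another one. -/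
theorem exists_hilbertBasis_diag_of_majorizedOn {ι : Type*} [DecidableEq ι] {A : H →L[ℂ] H}
    (hA : (A : H →ₗ[ℂ] H).IsSymmetric) (b : HilbertBasis ι ℂ H) {x y : ι → ℝ}
    (hb : ∀ n, ⟪b n, A (b n)⟫_ℂ = x n) {s : Finset ι} (hyx : MajorizedOn s y x)
    (hs : ∀ n, n ∉ s → y n = x n) :
    ∃ f : HilbertBasis ι ℂ H, ∀ n, ⟪f n, A (f n)⟫_ℂ = y n :=
  MajorizedOn.induction (P := fun x => ∃ f : HilbertBasis ι ℂ H, ∀ n, ⟪f n, A (f n)⟫_ℂ = x n)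
    (fun _ ⟨f, hf⟩ _ _ hij _ ht0 ht1 => exists_hilbertBasis_diag_averagePair hA f hf hij ht0 ht1)
    s hyx hs ⟨b, hb⟩

end Rotation

/-! ### Compactness of convex hulls -/

section ConvexHull

/-- In finite dimension the convex hull of a compact set is compact, by Carathéodory's theorem. -/
lemma isCompact_convexHull {E : Type*} [NormedAddCommGroup E] [NormedSpace ℝ E]
    [FiniteDimensional ℝ E] {s : Set E} (hs : IsCompact s) : IsCompact (convexHull ℝ s) := by
  set n := Module.finrank ℝ E + 1
  obtain rfl | ⟨x₀, hx₀⟩ := s.eq_empty_or_nonempty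
  · simp
  let F : (Fin n → ℝ) × (Fin n → E) → E := fun p => ∑ i, p.1 i • p.2 i
  have hF : Continuous F := by fun_prop
  have himg : convexHull ℝ s = F '' (stdSimplex ℝ (Fin n) ×ˢ univ.pi fun _ => s) := by
    refine Subset.antisymm (fun x hx => ?_) ?_
    · obtain ⟨ι, _, z, w, hz, hind, hw0, hw1, hx⟩ := eq_pos_convex_span_of_mem_convexHull hx
      obtain ⟨f⟩ : Nonempty (ι ↪ Fin n) := Function.Embedding.nonempty_of_card_le <| by
        rw [Fintype.card_fin]
        exact hind.card_le_finrank_succ.trans (Nat.succ_le_succ (Submodule.finrank_le _))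
      -- Unused slots of the Carathéodory combination get weight 0 and the dummy point x₀.
      have hw' : ∀ j, j ∉ range f → Function.extend f w 0 j = 0 := fun j hj =>
        Function.extend_apply' _ _ _ hj
      refine ⟨(Function.extend f w 0, Function.extend f z fun _ => x₀), ⟨⟨fun j => ?_, ?_⟩,
        fun j _ => ?_⟩, ?_⟩
      · by_cases hj : j ∈ range f
        · obtain ⟨i, rfl⟩ := hj
          simp only [f.injective.extend_apply]
          exact (hw0 i).le
        · exact (hw' j hj).ge
      · rw [← hw1]
        exact (Fintype.sum_of_injective f f.injective _ _ hw'
          fun i => (f.injective.extend_apply w 0 i).symm).symm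
      · by_cases hj : j ∈ range f
        · obtain ⟨i, rfl⟩ := hj
          simp only [f.injective.extend_apply]
          exact hz ⟨i, rfl⟩
        · simp only [Function.extend_apply' _ _ _ hj]
          exact hx₀
      · rw [← hx]
        refine (Fintype.sum_of_injective f f.injective _ _ (fun j hj => ?_) fun i => ?_).symm
        · simp only [hw' j hj, zero_smul]
        · simp only [f.injective.extend_apply]
    · rintro _ ⟨⟨w, z⟩, ⟨⟨hw0, hw1⟩, hz⟩, rfl⟩
      exact (convex_convexHull ℝ s).sum_mem (fun i _ => hw0 i) hw1
        fun i _ => subset_convexHull ℝ s (hz i (mem_univ i))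
  rw [himg]
  exact ((isCompact_stdSimplex ℝ _).prod (isCompact_univ_pi fun _ => hs)).image hF

end ConvexHull

/-! ### Permuted sums, Birkhoff's theorem and truncation -/

section Sums

/-- The sums `∑ₙ γₙ τ_{π(n)}`, where `π` runs through the finitely supported permutations. -/
def finSpectrum (γ τ : ℕ → ℂ) : Set ℂ :=
  {z | ∃ π : Equiv.Perm ℕ, (∃ s : Finset ℕ, ∀ n, n ∉ s → π n = n) ∧
    HasSum (fun n => γ n * τ (π n)) z}

lemma finSpectrum_subset_cSpectrum (γ τ : ℕ → ℂ) : finSpectrum γ τ ⊆ cSpectrum γ τ :=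
  fun _ ⟨π, _, h⟩ => ⟨π, h⟩

/-- Reindexing by π⁻¹ exchanges the two sequences, so either one may be taken as the real one up to
phase. -/
lemma finSpectrum_comm (γ τ : ℕ → ℂ) : finSpectrum γ τ ⊆ finSpectrum τ γ := by
  rintro z ⟨π, ⟨s, hs⟩, h⟩
  refine ⟨π⁻¹, ⟨s, fun n hn => ?_⟩, ?_⟩
  · rw [Equiv.Perm.inv_eq_iff_eq, hs n hn]
  · rw [← π.hasSum_iff]
    convert h using 2 with n
    simp [mul_comm]

lemma summable_mul_of_norm_le {γ a : ℕ → ℂ} {B : ℝ} (hγ : Summable γ) (ha : ∀ n, ‖a n‖ ≤ B) :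
    Summable fun n => γ n * a n :=
  Summable.of_norm_bounded (hγ.norm.mul_right B) fun n => by
    rw [norm_mul]
    exact mul_le_mul_of_nonneg_left (ha n) (norm_nonneg _)

/-- Below K the factors a and b are close; beyond K the weights γ have a small tail. -/
lemma norm_tsum_mul_sub_le {γ a b : ℕ → ℂ} {B ε : ℝ} {K : ℕ} (hγ : Summable γ)
    (ha : ∀ n, ‖a n‖ ≤ B) (hb : ∀ n, ‖b n‖ ≤ B) (hε : 0 ≤ ε) (hab : ∀ n < K, ‖a n - b n‖ ≤ ε) :
    ‖∑' n, γ n * a n - ∑' n, γ n * b n‖ ≤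
      (∑' n, ‖γ n‖) * ε + (∑' n, ‖γ (n + K)‖) * (2 * B) := by
  have hB : 0 ≤ B := (norm_nonneg _).trans (ha 0)
  have hsub : ∀ n, ‖a n - b n‖ ≤ 2 * B := fun n =>
    (norm_sub_le _ _).trans (by linarith [ha n, hb n])
  have hγn := hγ.norm
  rw [← (summable_mul_of_norm_le hγ ha).tsum_sub (summable_mul_of_norm_le hγ hb)]
  simp only [← mul_sub]
  have hs : Summable fun n => ‖γ n * (a n - b n)‖ := (summable_mul_of_norm_le hγ hsub).norm
  refine (norm_tsum_le_tsum_norm hs).trans ?_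
  rw [← hs.sum_add_tsum_nat_add K]
  refine add_le_add ?_ ?_
  · calc ∑ n ∈ Finset.range K, ‖γ n * (a n - b n)‖ ≤ ∑ n ∈ Finset.range K, ‖γ n‖ * ε := by
          refine Finset.sum_le_sum fun n hn => ?_
          rw [norm_mul]
          exact mul_le_mul_of_nonneg_left (hab n (Finset.mem_range.1 hn)) (norm_nonneg _)
      _ = (∑ n ∈ Finset.range K, ‖γ n‖) * ε := by rw [Finset.sum_mul]
      _ ≤ _ := mul_le_mul_of_nonneg_right
          (hγn.sum_le_tsum _ fun _ _ => norm_nonneg _) hε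
  · rw [← tsum_mul_right]
    refine ((summable_nat_add_iff K).2 hs).tsum_le_tsum (fun n => ?_)
      (((summable_nat_add_iff K).2 hγn).mul_right _)
    rw [norm_mul]
    exact mul_le_mul_of_nonneg_left (hsub _) (norm_nonneg _)

/-- Composing with the transposition of π N and σ N corrects the value at N; by injectivity it
leaves the earlier values alone. -/
lemma exists_finite_perm_eqOn (σ : Equiv.Perm ℕ) (N : ℕ) :
    ∃ π : Equiv.Perm ℕ, (∃ s : Finset ℕ, ∀ n, n ∉ s → π n = n) ∧ ∀ n < N, π n = σ n := by
  induction N with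
  | zero => exact ⟨1, ⟨∅, fun _ _ => rfl⟩, fun n hn => absurd hn (Nat.not_lt_zero n)⟩
  | succ N ih =>
    obtain ⟨π, ⟨s, hs⟩, hπ⟩ := ih
    refine ⟨Equiv.swap (π N) (σ N) * π, ⟨s ∪ {π N, σ N}, fun n hn => ?_⟩, fun n hn => ?_⟩
    · simp only [Finset.mem_union, Finset.mem_insert, Finset.mem_singleton, not_or] at hn
      rw [Equiv.Perm.mul_apply, hs n hn.1, Equiv.swap_apply_of_ne_of_ne hn.2.1 hn.2.2]
    · rw [Equiv.Perm.mul_apply]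
      rcases Nat.lt_succ_iff_lt_or_eq.1 hn with h | rfl
      · rw [Equiv.swap_apply_of_ne_of_ne, hπ n h]
        · exact fun h' => h.ne (π.injective h')
        · rw [hπ n h]
          exact fun h' => h.ne (σ.injective h')
      · rw [Equiv.swap_apply_left]

lemma exists_tsum_tail_lt {γ : ℕ → ℂ} {δ : ℝ} (hδ : 0 < δ) :
    ∃ K, ∀ N ≥ K, ∑' n, ‖γ (n + N)‖ < δ :=
  eventually_atTop.1 ((tendsto_sum_nat_add fun n => ‖γ n‖).eventually (gt_mem_nhds hδ))

lemma cSpectrum_subset_closure_finSpectrum {γ τ : ℕ → ℂ} {B : ℝ} (hγ : Summable γ)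
    (hτ : ∀ n, ‖τ n‖ ≤ B) : cSpectrum γ τ ⊆ closure (finSpectrum γ τ) := by
  rintro z ⟨σ, hσ⟩
  have hB : 0 ≤ B := (norm_nonneg _).trans (hτ 0)
  rw [Metric.mem_closure_iff]
  intro ε hε
  obtain ⟨K, hK⟩ := exists_tsum_tail_lt (γ := γ) (δ := ε / (2 * B + 1)) (by positivity)
  obtain ⟨π, hπ, hπσ⟩ := exists_finite_perm_eqOn σ K
  have hs : Summable fun n => γ n * τ (π n) := summable_mul_of_norm_le hγ fun n => hτ _
  refine ⟨_, ⟨π, hπ, hs.hasSum⟩, ?_⟩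
  rw [← hσ.tsum_eq, dist_eq_norm]
  have h := norm_tsum_mul_sub_le (a := fun n => τ (σ n)) (b := fun n => τ (π n)) (K := K) (ε := 0)
    hγ (fun n => hτ _) (fun n => hτ _) le_rfl fun n hn => by simp [hπσ n hn]
  rw [mul_zero, zero_add] at h
  refine h.trans_lt ?_
  have h1 := hK K le_rfl
  rw [lt_div_iff₀ (by positivity)] at h1
  have h2 : 0 ≤ ∑' n, ‖γ (n + K)‖ := tsum_nonneg fun _ => norm_nonneg _
  linarith

/-- A substochastic matrix is the corner of a doubly stochastic one, hence by Birkhoff's theorem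
the corner of a convex combination of permutation matrices. -/
lemma exists_perm_weights {κ : Type*} [Fintype κ] [DecidableEq κ] (S : κ → κ → ℝ)
    (hS : ∀ n m, 0 ≤ S n m) (hrow : ∀ n, ∑ m, S n m ≤ 1) (hcol : ∀ m, ∑ n, S n m ≤ 1) :
    ∃ w : Equiv.Perm (κ ⊕ κ) → ℝ, (∀ π, 0 ≤ w π) ∧ ∑ π, w π = 1 ∧
      ∀ (n : κ) (φ : κ ⊕ κ → ℂ), ∑ π, (w π : ℂ) * φ (π (Sum.inl n)) =
        ∑ m, (S n m : ℂ) * φ (Sum.inl m) + ((1 - ∑ m, S n m : ℝ) : ℂ) * φ (Sum.inr n) := by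
  -- The diagonal blocks supply what rows and columns of S lack, and the transpose balances the
  -- second half.
  let D : Matrix (κ ⊕ κ) (κ ⊕ κ) ℝ := Matrix.fromBlocks (Matrix.of S)
    (Matrix.diagonal fun n => 1 - ∑ m, S n m) (Matrix.diagonal fun m => 1 - ∑ n, S n m)
    (Matrix.of S).transpose
  have hD : D ∈ doublyStochastic ℝ (κ ⊕ κ) := by
    rw [mem_doublyStochastic_iff_sum]
    refine ⟨?_, ?_, ?_⟩
    · rintro (n | n) (m | m)
      · exact hS n m
      · simp only [D, Matrix.fromBlocks_apply₁₂, Matrix.diagonal_apply]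
        split_ifs
        exacts [sub_nonneg.2 (hrow n), le_rfl]
      · simp only [D, Matrix.fromBlocks_apply₂₁, Matrix.diagonal_apply]
        split_ifs
        exacts [sub_nonneg.2 (hcol n), le_rfl]
      · exact hS m n
    · rintro (n | n) <;> simp [D, Matrix.diagonal_apply]
    · rintro (n | n) <;> simp [D, Matrix.diagonal_apply]
  obtain ⟨w, hw0, hw1, hwD⟩ := exists_eq_sum_perm_of_mem_doublyStochastic hD
  refine ⟨w, hw0, hw1, fun n φ => ?_⟩
  have h1 : ∀ j, (D (Sum.inl n) j : ℂ) = ∑ π, (w π : ℂ) * (if π (Sum.inl n) = j then 1 else 0) := by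
    intro j
    rw [← hwD, Matrix.sum_apply]
    push_cast
    refine Finset.sum_congr rfl fun π _ => ?_
    by_cases h : π (Sum.inl n) = j <;>
      simp [Equiv.Perm.permMatrix, PEquiv.toMatrix_apply, h]
  have h2 : ∑ j, (D (Sum.inl n) j : ℂ) * φ j = ∑ π, (w π : ℂ) * φ (π (Sum.inl n)) := by
    simp only [h1, Finset.sum_mul]
    rw [Finset.sum_comm]
    refine Finset.sum_congr rfl fun π _ => ?_
    simp
  rw [← h2, Fintype.sum_sum_type]
  congr 1
  rw [Finset.sum_eq_single n (fun m _ hm => by simp [D, hm.symm])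
    fun h => absurd (Finset.mem_univ n) h]
  simp [D]

/-- The embedding of two copies of `Fin K` as consecutive intervals of `ℕ`. -/
def doubleFinEmbedding (K : ℕ) : Fin K ⊕ Fin K ↪ ℕ :=
  finSumFinEquiv.toEmbedding.trans Fin.valEmbedding

lemma doubleFinEmbedding_inl {K : ℕ} (n : Fin K) : doubleFinEmbedding K (Sum.inl n) = n := by
  simp [doubleFinEmbedding]

lemma doubleFinEmbedding_inr {K : ℕ} (n : Fin K) : doubleFinEmbedding K (Sum.inr n) = K + n := by
  simp [doubleFinEmbedding, add_comm]

/-- After completing the K × K corner, the missing row mass is placed at indices K, …, 2K - 1, where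
τ is already small. -/
lemma tsum_substochastic_mem_closure {γ τ : ℕ → ℂ} (hγ : Summable γ) (hτ : Tendsto τ atTop (𝓝 0))
    {S : ℕ → ℕ → ℝ} (hS : ∀ n m, 0 ≤ S n m) (hrow : ∀ n, Summable (S n))
    (hrow1 : ∀ n, ∑' m, S n m ≤ 1) (hcol : ∀ m K, ∑ n ∈ Finset.range K, S n m ≤ 1) :
    ∑' n, γ n * ∑' m, (S n m : ℂ) * τ m ∈ closure (convexHull ℝ (finSpectrum γ τ)) := by
  obtain ⟨B, hB⟩ : ∃ B, ∀ n, ‖τ n‖ ≤ B := by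
    obtain ⟨B, hB⟩ := hτ.norm.bddAbove_range
    exact ⟨B, fun n => hB ⟨n, rfl⟩⟩
  have hB0 : 0 ≤ B := (norm_nonneg _).trans (hB 0)
  have hrowC : ∀ n, Summable fun m => ‖(S n m : ℂ) * τ m‖ := fun n =>
    Summable.of_nonneg_of_le (fun _ => norm_nonneg _) (fun m => by
      rw [norm_mul, Complex.norm_real, Real.norm_of_nonneg (hS n m)]
      exact mul_le_mul_of_nonneg_left (hB m) (hS n m)) ((hrow n).mul_right B)
  -- a weighted sum with weights from a row of `S` is bounded by the entries it involves
  have hbound : ∀ n K δ, 0 ≤ δ → (∀ m, ‖τ (m + K)‖ ≤ δ) →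
      ‖∑' m, (S n (m + K) : ℂ) * τ (m + K)‖ ≤ δ := by
    intro n K δ hδ h
    have hs := (summable_nat_add_iff K).2 (hrow n)
    have hsK : ∑' m, S n (m + K) ≤ 1 := by
      refine le_trans ?_ (hrow1 n)
      rw [← (hrow n).sum_add_tsum_nat_add K]
      exact le_add_of_nonneg_left (Finset.sum_nonneg fun m _ => hS n m)
    calc ‖∑' m, (S n (m + K) : ℂ) * τ (m + K)‖
        ≤ ∑' m, ‖(S n (m + K) : ℂ) * τ (m + K)‖ :=
          norm_tsum_le_tsum_norm ((summable_nat_add_iff K).2 (hrowC n))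
      _ ≤ ∑' m, S n (m + K) * δ := by
          refine ((summable_nat_add_iff K).2 (hrowC n)).tsum_le_tsum (fun m => ?_) (hs.mul_right δ)
          rw [norm_mul, Complex.norm_real, Real.norm_of_nonneg (hS _ _)]
          exact mul_le_mul_of_nonneg_left (h m) (hS _ _)
      _ = (∑' m, S n (m + K)) * δ := tsum_mul_right
      _ ≤ 1 * δ := mul_le_mul_of_nonneg_right hsK hδ
      _ = δ := one_mul δ
  rw [Metric.mem_closure_iff]
  intro ε hε
  set G := ∑' n, ‖γ n‖ with hG
  have hG0 : 0 ≤ G := tsum_nonneg fun _ => norm_nonneg _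
  -- The total error will be at most G · 2δ + δ · 2B < ε.
  set δ := ε / (2 * G + 2 * B + 1) with hδ
  have hδ0 : 0 < δ := by positivity
  obtain ⟨K₁, hK₁⟩ := exists_tsum_tail_lt (γ := γ) hδ0
  obtain ⟨K₂, hK₂⟩ := eventually_atTop.1
    ((tendsto_zero_iff_norm_tendsto_zero.1 hτ).eventually (gt_mem_nhds hδ0))
  set K := max K₁ K₂ with hK
  have hKτ : ∀ m ≥ K, ‖τ m‖ ≤ δ := fun m hm => (hK₂ m ((le_max_right _ _).trans hm)).le
  obtain ⟨w, hw0, hw1, hw⟩ := exists_perm_weights (fun n m : Fin K => S n m)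
    (fun n m => hS n m)
    (fun n => by
      rw [Fin.sum_univ_eq_sum_range (fun m => S n m) K]
      exact ((hrow n).sum_le_tsum _ fun m _ => hS n m).trans (hrow1 n))
    (fun m => by
      rw [Fin.sum_univ_eq_sum_range (fun n => S n m) K]
      exact hcol m K)
  let e := doubleFinEmbedding K
  let P : Equiv.Perm (Fin K ⊕ Fin K) → Equiv.Perm ℕ := fun π => π.viaEmbedding e
  have hP : ∀ π j, P π (e j) = e (π j) := fun π j => Equiv.Perm.viaEmbedding_apply π e j
  have hPs : ∀ π, Summable fun n => γ n * τ (P π n) := fun π =>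
    summable_mul_of_norm_le hγ fun n => hB _
  let q : Equiv.Perm (Fin K ⊕ Fin K) → ℂ := fun π => ∑' n, γ n * τ (P π n)
  have hq : ∀ π, q π ∈ finSpectrum γ τ := fun π => by
    refine ⟨P π, ⟨Finset.univ.map e, fun n hn => ?_⟩, (hPs π).hasSum⟩
    refine Equiv.Perm.viaEmbedding_apply_of_notMem π e n ?_
    rintro ⟨j, rfl⟩
    exact hn (Finset.mem_map_of_mem e (Finset.mem_univ j))
  let b : ℕ → ℂ := fun n => ∑ π, (w π : ℂ) * τ (P π n)
  have hbB : ∀ n, ‖b n‖ ≤ B := fun n => by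
    calc ‖b n‖ ≤ ∑ π, ‖(w π : ℂ) * τ (P π n)‖ := norm_sum_le _ _
      _ ≤ ∑ π, w π * B := by
          refine Finset.sum_le_sum fun π _ => ?_
          rw [norm_mul, Complex.norm_real, Real.norm_of_nonneg (hw0 π)]
          exact mul_le_mul_of_nonneg_left (hB _) (hw0 π)
      _ = B := by rw [← Finset.sum_mul, hw1, one_mul]
  have hqb : ∑ π, w π • q π = ∑' n, γ n * b n := by
    have h : ∀ π ∈ Finset.univ, Summable fun n => (w π : ℂ) * (γ n * τ (P π n)) :=
      fun π _ => (hPs π).mul_left _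
    calc ∑ π, w π • q π = ∑ π, ∑' n, (w π : ℂ) * (γ n * τ (P π n)) := by
          refine Finset.sum_congr rfl fun π _ => ?_
          rw [tsum_mul_left, Complex.real_smul]
      _ = ∑' n, ∑ π, (w π : ℂ) * (γ n * τ (P π n)) := (Summable.tsum_finsetSum h).symm
      _ = ∑' n, γ n * b n := by
          refine tsum_congr fun n => ?_
          rw [Finset.mul_sum]
          exact Finset.sum_congr rfl fun π _ => by ring
  have haB : ∀ n, ‖∑' m, (S n m : ℂ) * τ m‖ ≤ B := fun n => hbound n 0 B hB0 fun m => hB _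
  -- One δ bounds the row beyond the corner, the other the entry carrying the missing row mass.
  have hab : ∀ n < K, ‖∑' m, (S n m : ℂ) * τ m - b n‖ ≤ 2 * δ := by
    intro n hn
    have h1 := (hrowC n).of_norm.sum_add_tsum_nat_add K
    have h2 := hw ⟨n, hn⟩ (fun j => τ (e j))
    have h3 : b n = ∑ π, (w π : ℂ) * τ (e (π (Sum.inl ⟨n, hn⟩))) := by
      refine Finset.sum_congr rfl fun π _ => ?_
      rw [← hP, show e (Sum.inl ⟨n, hn⟩) = n from doubleFinEmbedding_inl _]
    have h4 : ∑ m : Fin K, (S n m : ℂ) * τ (e (Sum.inl m)) =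
        ∑ m ∈ Finset.range K, (S n m : ℂ) * τ m := by
      rw [← Fin.sum_univ_eq_sum_range (fun m => (S n m : ℂ) * τ m) K]
      exact Finset.sum_congr rfl fun m _ => by
        rw [show e (Sum.inl m) = m from doubleFinEmbedding_inl _]
    have h5 : ∑ m : Fin K, S n m ≤ 1 := by
      rw [Fin.sum_univ_eq_sum_range (fun m => S n m) K]
      exact ((hrow n).sum_le_tsum _ fun m _ => hS n m).trans (hrow1 n)
    have h6 : 0 ≤ ∑ m : Fin K, S n m := Finset.sum_nonneg fun m _ => hS n m
    rw [h3, h2, ← h1, h4, add_sub_add_left_eq_sub, two_mul]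
    refine (norm_sub_le _ _).trans (add_le_add ?_ ?_)
    · exact hbound n K δ hδ0.le fun m => hKτ _ (Nat.le_add_left _ _)
    · rw [norm_mul, Complex.norm_real, Real.norm_of_nonneg (by linarith)]
      have h7 : ‖τ (e (Sum.inr ⟨n, hn⟩))‖ ≤ δ :=
        hKτ _ (by rw [show e (Sum.inr ⟨n, hn⟩) = K + n from doubleFinEmbedding_inr _]; omega)
      exact (mul_le_mul (by linarith) h7 (norm_nonneg _) zero_le_one).trans (one_mul δ).le
  refine ⟨∑ π, w π • q π, ?_, ?_⟩
  · exact (convex_convexHull ℝ _).sum_mem (fun π _ => hw0 π) hw1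
      fun π _ => subset_convexHull ℝ _ (hq π)
  · rw [hqb, dist_eq_norm]
    refine (norm_tsum_mul_sub_le hγ haB hbB (by positivity) hab).trans_lt ?_
    have h1 := hK₁ K (le_max_left _ _)
    have h2 : 0 ≤ ∑' n, ‖γ (n + K)‖ := tsum_nonneg fun _ => norm_nonneg _
    have h3 : δ * (2 * G + 2 * B + 1) = ε := div_mul_cancel₀ _ (by positivity)
    have h4 : (∑' n, ‖γ (n + K)‖) * (2 * B) ≤ δ * (2 * B) :=
      mul_le_mul_of_nonneg_right h1.le (by positivity)
    nlinarith

/-- Finite modifications of r majorized by r form a convex set containing the finite rearrangements,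
so only their sums have to be found in W. -/
lemma convexHull_finSpectrum_subset {α : ℕ → ℂ} {ω : ℂ} {r : ℕ → ℝ} {W : Set ℂ}
    (hW : ∀ (s : Finset ℕ) (y : ℕ → ℝ), MajorizedOn s y r → (∀ n, n ∉ s → y n = r n) →
      ∀ z, HasSum (fun n => α n * (ω * y n)) z → z ∈ W) :
    convexHull ℝ (finSpectrum α fun n => ω * r n) ⊆ W := by
  let V : Set ℂ := {z | ∃ (s : Finset ℕ) (y : ℕ → ℝ), MajorizedOn s y r ∧
    (∀ n, n ∉ s → y n = r n) ∧ HasSum (fun n => α n * (ω * y n)) z}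
  have hV : Convex ℝ V := by
    rintro z ⟨s, y, hy, hys, hz⟩ z' ⟨s', y', hy', hys', hz'⟩ a b ha hb hab
    refine ⟨s ∪ s', a • y + b • y', ?_, fun n hn => ?_, ?_⟩
    · exact convex_majorizedOn _ r (hy.mono hys Finset.subset_union_left)
        (hy'.mono hys' Finset.subset_union_right) ha hb hab
    · rw [Finset.mem_union, not_or] at hn
      simp only [Pi.add_apply, Pi.smul_apply, smul_eq_mul, hys n hn.1, hys' n hn.2, ← add_mul, hab,
        one_mul]
    · rw [Complex.real_smul, Complex.real_smul]
      refine ((hz.mul_left (a : ℂ)).add (hz'.mul_left (b : ℂ))).congr_fun ?_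
      intro n
      simp only [Pi.add_apply, Pi.smul_apply, smul_eq_mul]
      push_cast
      ring
  have hsub : (finSpectrum α fun n => ω * r n) ⊆ V := by
    rintro z ⟨π, ⟨s, hs⟩, hz⟩
    exact ⟨s, fun n => r (π n), majorizedOn_comp_perm r π hs, fun n hn => congrArg r (hs n hn), hz⟩
  exact (convexHull_min hsub hV).trans fun z ⟨s, y, h1, h2, h3⟩ => hW s y h1 h2 z h3

end Sums

/-! ### The two inclusions for the numerical range -/

section Range

variable {H : Type*} [NormedAddCommGroup H] [InnerProductSpace ℂ H] [CompleteSpace H]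

lemma exists_unitary_apply_eq {ι : Type*} (e b : HilbertBasis ι ℂ H) :
    ∃ U ∈ unitary (H →L[ℂ] H), ∀ n, U (e n) = b n := by
  classical
  let u := Unitary.linearIsometryEquiv.symm (e.repr.trans b.repr.symm)
  refine ⟨u, u.2, fun n => ?_⟩
  change b.repr.symm (e.repr (e n)) = b n
  rw [e.repr_self, b.repr_symm_single]

lemma star_apply_apply_of_mem_unitary {U : H →L[ℂ] H} (hU : U ∈ unitary (H →L[ℂ] H)) (x : H) :
    star U (U x) = x := by
  rw [← mul_apply_eq_comp, Unitary.star_mul_self_of_mem hU,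
    one_apply_eq_self]

lemma inner_star_mul_mul_self (U T : H →L[ℂ] H) (x y : H) :
    ⟪x, (star U * T * U) y⟫_ℂ = ⟪U x, T (U y)⟫_ℂ := by
  rw [ContinuousLinearMap.star_eq_adjoint]
  exact ContinuousLinearMap.adjoint_inner_right U x (T (U y))

/-- The trace of `C U† T U` in terms of an eigenbasis of `C`. -/
lemma hasSum_opTrace_of_eigenbasis {C : H →L[ℂ] H} (hC : IsTraceClass C) (hCn : IsStarNormal C)
    {e : HilbertBasis ℕ ℂ H} {γ : ℕ → ℂ} (he : ∀ n, C (e n) = γ n • e n) (U T : H →L[ℂ] H) :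
    HasSum (fun n => γ n * ⟪U (e n), T (U (e n))⟫_ℂ) (opTrace (C * (star U * T * U))) := by
  convert hC.hasSum_opTrace_mul (star U * T * U) e using 2 with n
  rw [mul_apply_eq_comp, ← ContinuousLinearMap.adjoint_inner_left C,
    adjoint_apply_of_apply_eq_smul hCn (he n), inner_smul_left, Complex.conj_conj,
    inner_star_mul_mul_self]

lemma hasSum_inner_apply_of_eigenbasis {T : H →L[ℂ] H} (hTn : IsStarNormal T)
    {f : HilbertBasis ℕ ℂ H} {τ : ℕ → ℂ} (hf : ∀ n, T (f n) = τ n • f n) (x : H) :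
    HasSum (fun m => ((‖⟪f m, x⟫_ℂ‖ ^ 2 : ℝ) : ℂ) * τ m) ⟪x, T x⟫_ℂ := by
  refine (f.hasSum_inner_mul_inner x (T x)).congr_fun fun m => ?_
  rw [← ContinuousLinearMap.adjoint_inner_left T, adjoint_apply_of_apply_eq_smul hTn (hf m),
    inner_smul_left, Complex.conj_conj, mul_left_comm, ← inner_conj_symm x (f m),
    ← Complex.normSq_eq_conj_mul_self, Complex.normSq_eq_norm_sq, mul_comm]

/-- The weights |⟨fₘ, U eₙ⟩|² are substochastic: Bessel for f bounds the rows, Bessel for U e the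
columns. -/
lemma cNumericalRange_subset {C T : H →L[ℂ] H} (hC : IsTraceClass C) (hCn : IsStarNormal C)
    (hTc : IsCompactOperator T) (hTn : IsStarNormal T) {e f : HilbertBasis ℕ ℂ H} {γ τ : ℕ → ℂ}
    (he : ∀ n, C (e n) = γ n • e n) (hf : ∀ n, T (f n) = τ n • f n) :
    cNumericalRange C T ⊆ closure (convexHull ℝ (finSpectrum γ τ)) := by
  rintro z ⟨U, hU, rfl⟩
  have hUe : Orthonormal ℂ fun n => U (e n) := by
    rw [orthonormal_iff_ite]
    intro m n
    rw [← ContinuousLinearMap.adjoint_inner_right, ← ContinuousLinearMap.star_eq_adjoint,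
      star_apply_apply_of_mem_unitary hU]
    exact orthonormal_iff_ite.1 e.orthonormal m n
  have h1 := hasSum_opTrace_of_eigenbasis hC hCn he U T
  rw [← h1.tsum_eq]
  simp only [← (hasSum_inner_apply_of_eigenbasis hTn hf _).tsum_eq]
  refine tsum_substochastic_mem_closure (S := fun n m => ‖⟪f m, U (e n)⟫_ℂ‖ ^ 2)
    (summable_of_isTraceClass hC he) (tendsto_eigenvalues_zero hTc f.orthonormal hf)
    (fun _ _ => sq_nonneg _) (fun n => f.orthonormal.inner_products_summable _) (fun n => ?_)
    fun m K => ?_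
  · simpa [hUe.1 n] using f.orthonormal.tsum_inner_products_le (U (e n))
  · have := hUe.sum_inner_products_le (f m) (s := Finset.range K)
    simp only [f.orthonormal.1 m, one_pow] at this
    refine le_trans (Finset.sum_le_sum fun n _ => ?_) this
    rw [norm_inner_symm]

/-- The vectors γₘ - γₖ and γₙ - γₖ are real-parallel; letting k → ∞ shows that γₘ and γₙ are too.
The phase of a nonzero term serves as ω. -/
lemma exists_real_of_collinear {s : Set ℂ} (hs : Collinear ℝ s) {γ : ℕ → ℂ} (hγs : ∀ n, γ n ∈ s)
    (hγ : Tendsto γ atTop (𝓝 0)) :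
    ∃ (ω : ℂ) (r : ℕ → ℝ), starRingEnd ℂ ω * ω = 1 ∧ ∀ n, γ n = ω * r n := by
  obtain ⟨p, v, hv⟩ := (collinear_iff_exists_forall_eq_smul_vadd s).1 hs
  choose t ht using fun n => hv (γ n) (hγs n)
  have hcross : ∀ n m, (starRingEnd ℂ (γ m) * γ n).im = 0 := by
    intro n m
    have h1 : ∀ k, (starRingEnd ℂ (γ m - γ k) * (γ n - γ k)).im = 0 := by
      intro k
      have e1 : γ m - γ k = ((t m - t k : ℝ) : ℂ) * v := by
        rw [ht m, ht k]; simp [Complex.real_smul]; ring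
      have e2 : γ n - γ k = ((t n - t k : ℝ) : ℂ) * v := by
        rw [ht n, ht k]; simp [Complex.real_smul]; ring
      rw [e1, e2, map_mul, Complex.conj_ofReal, mul_mul_mul_comm, ← Complex.normSq_eq_conj_mul_self,
        ← Complex.ofReal_mul, ← Complex.ofReal_mul, Complex.ofReal_im]
    have hcont : Continuous fun u : ℂ => (starRingEnd ℂ (γ m - u) * (γ n - u)).im := by fun_prop
    have h2 := (hcont.tendsto 0).comp hγ
    simp only [sub_zero] at h2
    refine tendsto_nhds_unique h2 ?_
    simp only [Function.comp_def, h1]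
    exact tendsto_const_nhds
  by_cases h0 : ∀ n, γ n = 0
  · exact ⟨1, 0, by simp, fun n => by simp [h0 n]⟩
  · push Not at h0
    obtain ⟨m, hm⟩ := h0
    have hn : (‖γ m‖ : ℂ) ≠ 0 := by simpa using hm
    have hmm : starRingEnd ℂ (γ m) * γ m = ‖γ m‖ * ‖γ m‖ := by
      rw [← Complex.normSq_eq_conj_mul_self, Complex.normSq_eq_norm_sq]; push_cast; ring
    refine ⟨γ m / ‖γ m‖, fun n => (starRingEnd ℂ (γ m) * γ n).re / ‖γ m‖, ?_, fun n => ?_⟩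
    · rw [map_div₀, Complex.conj_ofReal, div_mul_div_comm, hmm, div_self (mul_ne_zero hn hn)]
    · have h3 : (((starRingEnd ℂ (γ m) * γ n).re : ℝ) : ℂ) = starRingEnd ℂ (γ m) * γ n :=
        Complex.ext (by simp) (by rw [Complex.ofReal_im, hcross])
      rw [Complex.ofReal_div, h3, div_mul_div_comm, ← mul_assoc, mul_comm (γ m), hmm,
        mul_div_cancel_left₀ _ (mul_ne_zero hn hn)]

/-- **Horn's theorem** for a compact normal operator with collinear eigenvalues. -/
lemma exists_hilbertBasis_diag {A : H →L[ℂ] H} (hAn : IsStarNormal A) {e : HilbertBasis ℕ ℂ H}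
    {ω : ℂ} {r : ℕ → ℝ} (hω : starRingEnd ℂ ω * ω = 1)
    (he : ∀ n, A (e n) = (ω * r n) • e n) {s : Finset ℕ} {y : ℕ → ℝ} (hy : MajorizedOn s y r)
    (hs : ∀ n, n ∉ s → y n = r n) :
    ∃ b : HilbertBasis ℕ ℂ H, ∀ n, ⟪b n, A (b n)⟫_ℂ = ω * y n := by
  -- Removing the phase leaves real eigenvalues, so A' is self-adjoint.
  set A' : H →L[ℂ] H := starRingEnd ℂ ω • A with hA'
  have hA'e : ∀ n, A' (e n) = (r n : ℂ) • e n := fun n => by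
    rw [hA', smul_apply, he n, smul_smul, ← mul_assoc, hω, one_mul]
  have hA'e' : ∀ n, ContinuousLinearMap.adjoint A' (e n) = (r n : ℂ) • e n := fun n => by
    have : ContinuousLinearMap.adjoint A' = ω • ContinuousLinearMap.adjoint A := by
      rw [hA', ← ContinuousLinearMap.star_eq_adjoint, star_smul,
        ContinuousLinearMap.star_eq_adjoint]
      simp
    rw [this, smul_apply, adjoint_apply_of_apply_eq_smul hAn (he n), smul_smul,
      map_mul, Complex.conj_ofReal, ← mul_assoc, mul_comm ω, hω, one_mul]
  have hsymm : (A' : H →ₗ[ℂ] H).IsSymmetric := by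
    intro x z
    have h : ContinuousLinearMap.adjoint A' z = A' z := by
      rw [← sub_eq_zero]
      refine HilbertBasis.eq_zero_of_inner_eq_zero e fun n => ?_
      rw [inner_sub_right, ContinuousLinearMap.adjoint_inner_right,
        ← ContinuousLinearMap.adjoint_inner_left A', hA'e, hA'e', sub_self]
    exact (ContinuousLinearMap.adjoint_inner_right A' x z).symm.trans (by rw [h]; rfl)
  obtain ⟨b, hb⟩ := exists_hilbertBasis_diag_of_majorizedOn hsymm e
    (fun n => by simp [hA'e n, e.orthonormal.1 n, inner_self_eq_norm_sq_to_K])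
    hy hs
  refine ⟨b, fun n => ?_⟩
  rw [← hb n, hA', smul_apply, inner_smul_right, ← mul_assoc, mul_comm ω, hω,
    one_mul]

omit [CompleteSpace H] in
lemma mem_eigenvalues_of_hilbertBasis {A : H →L[ℂ] H} {e : HilbertBasis ℕ ℂ H} {γ : ℕ → ℂ}
    (he : ∀ n, A (e n) = γ n • e n) (n : ℕ) : γ n ∈ eigenvalues A :=
  Module.End.hasEigenvalue_of_hasEigenvector
    ⟨Module.End.mem_eigenspace_iff.2 (he n), e.orthonormal.ne_zero n⟩

lemma convexHull_finSpectrum_subset_cNumericalRange {C T : H →L[ℂ] H} (hC : IsTraceClass C)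
    (hCn : IsStarNormal C) (hTc : IsCompactOperator T) (hTn : IsStarNormal T)
    (hcol : Collinear ℝ (eigenvalues C) ∨ Collinear ℝ (eigenvalues T))
    {e f : HilbertBasis ℕ ℂ H} {γ τ : ℕ → ℂ}
    (he : ∀ n, C (e n) = γ n • e n) (hf : ∀ n, T (f n) = τ n • f n) :
    convexHull ℝ (finSpectrum γ τ) ⊆ cNumericalRange C T := by
  rcases hcol with hcol | hcol
  · obtain ⟨ω, r, hω, hr⟩ := exists_real_of_collinear hcol (mem_eigenvalues_of_hilbertBasis he)
      (tendsto_eigenvalues_zero hC.1 e.orthonormal he)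
    refine (convexHull_mono (finSpectrum_comm γ τ)).trans ?_
    rw [show γ = fun n => ω * r n from funext hr]
    refine convexHull_finSpectrum_subset fun s y hy hs z hz => ?_
    obtain ⟨b, hb⟩ := exists_hilbertBasis_diag hCn hω (fun n => by rw [he n, hr n]) hy hs
    -- Here the basis of C is the one modified: U†TU becomes diagonal in b with entries τ, and C has
    -- diagonal ω y there.
    obtain ⟨U, hU, hUb⟩ := exists_unitary_apply_eq b f
    refine ⟨U, hU, hz.unique ?_⟩
    convert hC.hasSum_opTrace_mul (star U * T * U) b using 2 with n
    have : (star U * T * U) (b n) = τ n • b n := by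
      rw [mul_apply_eq_comp, mul_apply_eq_comp, hUb, hf, map_smul, ← hUb,
        star_apply_apply_of_mem_unitary hU]
    rw [mul_apply_eq_comp, this, map_smul, inner_smul_right, hb]
  · obtain ⟨ω, r, hω, hr⟩ := exists_real_of_collinear hcol (mem_eigenvalues_of_hilbertBasis hf)
      (tendsto_eigenvalues_zero hTc f.orthonormal hf)
    rw [show τ = fun n => ω * r n from funext hr]
    refine convexHull_finSpectrum_subset fun s y hy hs z hz => ?_
    obtain ⟨b, hb⟩ := exists_hilbertBasis_diag hTn hω (fun n => by rw [hf n, hr n]) hy hs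
    obtain ⟨U, hU, hUb⟩ := exists_unitary_apply_eq e b
    refine ⟨U, hU, hz.unique ?_⟩
    convert hasSum_opTrace_of_eigenbasis hC hCn he U T using 3 with n
    rw [hUb, hb]

end Range

end CNumRange

/-! ### Passage to closures -/

theorem corollary3p1 {H : Type*} [NormedAddCommGroup H] [InnerProductSpace ℂ H] [CompleteSpace H]
    [TopologicalSpace.SeparableSpace H] (hdim : ¬ FiniteDimensional ℂ H)
    (C T : H →L[ℂ] H) (hC : CNumRange.IsTraceClass C) (hT : IsCompactOperator T)
    (hCn : IsStarNormal C) (hTn : IsStarNormal T)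
    (hcol : Collinear ℝ (CNumRange.eigenvalues C) ∨ Collinear ℝ (CNumRange.eigenvalues T)) :
    (∃ γ : ℕ → ℂ, CNumRange.IsModifiedEigenvalueSeq C γ) ∧
    (∃ τ : ℕ → ℂ, CNumRange.IsModifiedEigenvalueSeq T τ) ∧
    ∀ γ τ : ℕ → ℂ, CNumRange.IsModifiedEigenvalueSeq C γ → CNumRange.IsModifiedEigenvalueSeq T τ →
      (∀ σ : Equiv.Perm ℕ, Summable fun n => γ n * τ (σ n)) ∧
      closure (CNumRange.cNumericalRange C T) =
        convexHull ℝ (closure (CNumRange.cSpectrum γ τ)) := by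
  open CNumRange in
  refine ⟨exists_isModifiedEigenvalueSeq hdim hC.1 hCn, exists_isModifiedEigenvalueSeq hdim hT hTn,
    fun γ τ hγ hτ => ?_⟩
  obtain ⟨e, he⟩ := hγ.exists_eigenbasis hdim hC.1 hCn
  obtain ⟨f, hf⟩ := hτ.exists_eigenbasis hdim hT hTn
  have hγs := CNumRange.summable_of_isTraceClass hC he
  obtain ⟨B, hB⟩ := (CNumRange.tendsto_eigenvalues_zero hT f.orthonormal hf).norm.bddAbove_range
  replace hB : ∀ n, ‖τ n‖ ≤ B := fun n => hB ⟨n, rfl⟩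
  refine ⟨fun σ => CNumRange.summable_mul_of_norm_le hγs fun n => hB _, Subset.antisymm ?_ ?_⟩
  -- Boundedness makes the hull of the closure compact, hence closed, so it absorbs the closures on
  -- the left.
  · have hbdd : Bornology.IsBounded (CNumRange.cSpectrum γ τ) := by
      rw [isBounded_iff_forall_norm_le]
      refine ⟨∑' n, ‖γ n‖ * B, ?_⟩
      rintro z ⟨σ, hσ⟩
      rw [← hσ.tsum_eq]
      refine tsum_of_norm_bounded (hγs.norm.mul_right B).hasSum fun n => ?_
      rw [norm_mul]
      exact mul_le_mul_of_nonneg_left (hB _) (norm_nonneg _)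
    have hclosed : IsClosed (convexHull ℝ (closure (CNumRange.cSpectrum γ τ))) :=
      (CNumRange.isCompact_convexHull hbdd.isCompact_closure).isClosed
    refine closure_minimal ?_ hclosed
    refine (CNumRange.cNumericalRange_subset hC hCn hT hTn he hf).trans ?_
    exact closure_minimal (convexHull_mono
      ((CNumRange.finSpectrum_subset_cSpectrum γ τ).trans subset_closure)) hclosed
  · have h1 : CNumRange.cSpectrum γ τ ⊆ closure (convexHull ℝ (CNumRange.finSpectrum γ τ)) :=
      (CNumRange.cSpectrum_subset_closure_finSpectrum hγs hB).trans
        (closure_mono (subset_convexHull ℝ _))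
    exact (convexHull_min (closure_minimal h1 isClosed_closure)
      (convex_convexHull ℝ _).closure).trans (closure_mono
        (CNumRange.convexHull_finSpectrum_subset_cNumericalRange hC hCn hT hTn hcol he hf))
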